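/- Let $A=\bigoplus_{n\in\mathbb Z}A_n$ be a $\mathbb Z$-graded ring with identity. Modules are right modules; a graded $A$-module is a right $A$-module $M=\bigoplus_{n\in\mathbb Z}M_n$ with $M_nA_m\subseteq M_{n+m}$, graded homomorphisms preserve degrees, and $M(1)$ denotes the graded module with $M(1)_n=M_{n+1}$. Let $K_0(A)$ (respectively $K_0^{\mathrm{gr}}(A)$) be the group completion of the monoid, under direct sum, of isomorphism classes of finitely generated projective right $A$-modules (respectively of graded isomorphism classes of graded finitely generated projective right $A$-modules). Suppose that $A$ is graded right Noetherian (graded right ideals satisfy the ascending chain condition) and graded right regular (the graded right global dimension is finite, i.e. there is an $n$ such that every graded right $A$-module has a graded projective resolution of length at most $n$). Then the functor forgetting the grading induces an isomorphism of abelian groups \[ K_0^{\mathrm{gr}}(A)\,/\,\langle [P(1)]-[P]\rangle\;\xrightarrow{\ \cong\ }\;K_0(A),\qquad [P]\longmapsto [P], \] where $\langle [P(1)]-[P]\rangle$ is the subgroup generated by the elements $[P(1)]-[P]$ for all graded finitely generated projective right $A$-modules $P$. -/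

import Mathlib

universe u

namespace GrK

/-! ## Graded right modules

A right `A`-module is a module over `Aᵐᵒᵖ`; the product `m a` is `MulOpposite.op a • m`. -/

/-- A `ℤ`-graded right module over `A`, where `A` is graded by the additive subgroups `𝓐 n`. -/
structure GrMod {A : Type u} [Ring A] (𝓐 : ℤ → AddSubgroup A) : Type (u + 1) where
  carrier : Type u
  [addCommGroup : AddCommGroup carrier]
  [module : Module Aᵐᵒᵖ carrier]
  /-- the homogeneous components -/
  deg : ℤ → AddSubgroup carrier
  isInternal : DirectSum.IsInternal deg
  smul_mem : ∀ {i j : ℤ} {m : carrier} {a : A},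
    m ∈ deg i → a ∈ 𝓐 j → MulOpposite.op a • m ∈ deg (i + j)

instance {A : Type u} [Ring A] (𝓐 : ℤ → AddSubgroup A) : CoeSort (GrMod 𝓐) (Type u) :=
  ⟨GrMod.carrier⟩

attribute [instance] GrMod.addCommGroup GrMod.module

/-- Graded homomorphisms (of degree zero) of graded right modules. -/
structure GrHom {A : Type u} [Ring A] {𝓐 : ℤ → AddSubgroup A} (M N : GrMod 𝓐) : Type u where
  toLin : M →ₗ[Aᵐᵒᵖ] N
  map_deg : ∀ (n : ℤ) (x : M), x ∈ M.deg n → toLin x ∈ N.deg n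

/-- Graded isomorphism of graded right modules. -/
def GrIso {A : Type u} [Ring A] {𝓐 : ℤ → AddSubgroup A} (M N : GrMod 𝓐) : Prop :=
  ∃ e : M ≃ₗ[Aᵐᵒᵖ] N, ∀ (n : ℤ) (x : M), e x ∈ N.deg n ↔ x ∈ M.deg n

/-- Graded projective modules: projective objects of the category of graded right modules. -/
def GrMod.IsGrProjective {A : Type u} [Ring A] {𝓐 : ℤ → AddSubgroup A} (P : GrMod 𝓐) : Prop :=
  ∀ (M N : GrMod 𝓐) (g : GrHom M N) (j : GrHom P N), Function.Surjective g.toLin →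
    ∃ h : GrHom P M, ∀ x, g.toLin (h.toLin x) = j.toLin x

/-- A criterion for a family of subgroups to be a grading, by means of projections. -/
theorem isInternal_of_proj {M : Type*} [AddCommGroup M] (D : ℤ → AddSubgroup M)
    (p : ℤ → M →+ M) (same : ∀ i, ∀ x ∈ D i, p i x = x)
    (ne : ∀ i j, i ≠ j → ∀ x ∈ D j, p i x = 0)
    (cover : ∀ x, x ∈ ⨆ i, D i) : DirectSum.IsInternal D := by
  classical
  constructor
  · have key : ∀ (i : ℤ) (f : DirectSum ℤ fun i => D i),
        (p i) (DirectSum.coeAddMonoidHom D f) = (f i : M) := by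
      intro i f
      induction f using DirectSum.induction_on with
      | zero => simp
      | of j x =>
        rw [DirectSum.coeAddMonoidHom_of]
        by_cases h : i = j
        · subst h
          rw [same i _ x.2, DirectSum.of_eq_same]
        · rw [ne i j h _ x.2, DirectSum.of_eq_of_ne _ _ _ h]
          rfl
      | add x y hx hy => rw [map_add, map_add, hx, hy]; rfl
    rw [injective_iff_map_eq_zero]
    intro f hf
    ext i
    have := key i f
    rw [hf, map_zero] at this
    simpa using this.symm
  · intro x
    have h : (⨆ i, D i) ≤ (DirectSum.coeAddMonoidHom D).range := by
      refine iSup_le fun i y hy => ?_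
      exact ⟨DirectSum.of (fun i => D i) i ⟨y, hy⟩, by simp⟩
    exact h (cover x)

theorem GrMod.mem_iSup_deg {A : Type u} [Ring A] {𝓐 : ℤ → AddSubgroup A} (M : GrMod 𝓐) (x : M) :
    x ∈ ⨆ i, M.deg i := by
  classical
  obtain ⟨f, rfl⟩ := M.isInternal.2 x
  induction f using DirectSum.induction_on with
  | zero => simp
  | of i x => simpa using AddSubgroup.mem_iSup_of_mem i x.2
  | add x y hx hy => rw [map_add]; exact add_mem hx hy

/-- The projection of a graded module to its component of degree `i`. -/
noncomputable def GrMod.proj {A : Type u} [Ring A] {𝓐 : ℤ → AddSubgroup A} (M : GrMod 𝓐) (i : ℤ) :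
    M →+ M :=
  letI := M.isInternal.chooseDecomposition
  AddMonoidHom.mk' (fun x => (DirectSum.decompose M.deg x i : M)) (fun x y => by
    rw [DirectSum.decompose_add]; rfl)

theorem GrMod.proj_same {A : Type u} [Ring A] {𝓐 : ℤ → AddSubgroup A} (M : GrMod 𝓐) (i : ℤ)
    (x : M) (hx : x ∈ M.deg i) : M.proj i x = x :=
  letI := M.isInternal.chooseDecomposition
  DirectSum.decompose_of_mem_same M.deg hx

theorem GrMod.proj_ne {A : Type u} [Ring A] {𝓐 : ℤ → AddSubgroup A} (M : GrMod 𝓐) (i j : ℤ)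
    (h : i ≠ j) (x : M) (hx : x ∈ M.deg j) : M.proj i x = 0 :=
  letI := M.isInternal.chooseDecomposition
  DirectSum.decompose_of_mem_ne M.deg hx (Ne.symm h)

/-- The shifted module `M(d)`, with `M(d)_n = M_{d+n}`. -/
abbrev GrMod.shift {A : Type u} [Ring A] {𝓐 : ℤ → AddSubgroup A} (M : GrMod 𝓐) (d : ℤ) :
    GrMod 𝓐 where
  carrier := M
  deg n := M.deg (d + n)
  isInternal := by
    refine isInternal_of_proj _ (fun i => M.proj (d + i)) (fun i x hx => M.proj_same _ x hx)
      (fun i j h x hx => M.proj_ne _ _ (by omega) x hx) (fun x => ?_)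
    have h : (⨆ i, M.deg i) ≤ ⨆ i, M.deg (d + i) := by
      refine iSup_le fun i => ?_
      refine le_trans (le_of_eq ?_) (le_iSup (fun i => M.deg (d + i)) (i - d))
      congr 1
      omega
    exact h (M.mem_iSup_deg x)
  smul_mem := fun hm ha => by
    rw [← add_assoc]
    exact M.smul_mem hm ha

/-- The direct sum of two graded modules. -/
abbrev GrMod.prod {A : Type u} [Ring A] {𝓐 : ℤ → AddSubgroup A} (M N : GrMod 𝓐) : GrMod 𝓐 where
  carrier := M × N
  deg n := (M.deg n).prod (N.deg n)
  isInternal := by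
    refine isInternal_of_proj _ (fun i => (M.proj i).prodMap (N.proj i)) ?_ ?_ ?_
    · rintro i ⟨x, y⟩ ⟨hx, hy⟩
      exact Prod.ext (M.proj_same i x hx) (N.proj_same i y hy)
    · rintro i j h ⟨x, y⟩ ⟨hx, hy⟩
      exact Prod.ext (M.proj_ne i j h x hx) (N.proj_ne i j h y hy)
    · rintro ⟨x, y⟩
      have h1 : (⨆ i, M.deg i) ≤
          (⨆ i, (M.deg i).prod (N.deg i)).comap (AddMonoidHom.inl M N) :=
        iSup_le fun i z hz => AddSubgroup.mem_iSup_of_mem i ⟨hz, zero_mem _⟩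
      have h2 : (⨆ i, N.deg i) ≤
          (⨆ i, (M.deg i).prod (N.deg i)).comap (AddMonoidHom.inr M N) :=
        iSup_le fun i z hz => AddSubgroup.mem_iSup_of_mem i ⟨zero_mem _, hz⟩
      have e1 : (x, (0 : N)) ∈ ⨆ i, (M.deg i).prod (N.deg i) := h1 (M.mem_iSup_deg x)
      have e2 : ((0 : M), y) ∈ ⨆ i, (M.deg i).prod (N.deg i) := h2 (N.mem_iSup_deg y)
      simpa using add_mem e1 e2
  smul_mem := fun hm ha => ⟨M.smul_mem hm.1 ha, N.smul_mem hm.2 ha⟩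

/-- The zero graded module. -/
abbrev GrMod.zero {A : Type u} [Ring A] (𝓐 : ℤ → AddSubgroup A) : GrMod 𝓐 where
  carrier := PUnit
  deg _ := ⊤
  isInternal := isInternal_of_proj _ (fun _ => 0) (fun _ _ _ => rfl) (fun _ _ _ _ _ => rfl)
    (fun _ => AddSubgroup.mem_iSup_of_mem 0 trivial)
  smul_mem := fun _ _ => trivial

theorem GrMod.IsGrProjective.shift {A : Type u} [Ring A] {𝓐 : ℤ → AddSubgroup A} {P : GrMod 𝓐}
    (hP : P.IsGrProjective) (d : ℤ) : (P.shift d).IsGrProjective := by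
  intro M N g j hg
  obtain ⟨h, hh⟩ := hP (M.shift (-d)) (N.shift (-d))
    ⟨g.toLin, fun n x hx => g.map_deg (-d + n) x hx⟩
    ⟨j.toLin, fun n x hx => j.map_deg (-d + n) x (by
      change x ∈ P.deg (d + (-d + n))
      simpa using hx)⟩ hg
  refine ⟨⟨h.toLin, fun n x hx => ?_⟩, hh⟩
  have := h.map_deg (d + n) x hx
  change h.toLin x ∈ M.deg (-d + (d + n)) at this
  simpa using this

theorem GrMod.IsGrProjective.prod {A : Type u} [Ring A] {𝓐 : ℤ → AddSubgroup A} {P Q : GrMod 𝓐}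
    (hP : P.IsGrProjective) (hQ : Q.IsGrProjective) : (P.prod Q).IsGrProjective := by
  intro M N g j hg
  obtain ⟨h, hh⟩ := hP M N g
    ⟨j.toLin.comp (LinearMap.inl Aᵐᵒᵖ P Q), fun n x hx => j.map_deg n _ ⟨hx, zero_mem _⟩⟩ hg
  obtain ⟨k, hk⟩ := hQ M N g
    ⟨j.toLin.comp (LinearMap.inr Aᵐᵒᵖ P Q), fun n x hx => j.map_deg n _ ⟨zero_mem _, hx⟩⟩ hg
  refine ⟨⟨h.toLin.coprod k.toLin, fun n x hx =>
    add_mem (h.map_deg n _ hx.1) (k.map_deg n _ hx.2)⟩, ?_⟩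
  rintro ⟨x, y⟩
  have e : (h.toLin.coprod k.toLin) (x, y) = h.toLin x + k.toLin y := by simp
  change g.toLin ((h.toLin.coprod k.toLin) (x, y)) = _
  rw [e, map_add, hh, hk]
  change j.toLin (x, 0) + j.toLin (0, y) = _
  rw [← map_add]
  congr 1
  exact Prod.ext (add_zero x) (zero_add y)

theorem GrMod.isGrProjective_zero {A : Type u} [Ring A] (𝓐 : ℤ → AddSubgroup A) :
    (GrMod.zero 𝓐).IsGrProjective := by
  intro M N g j hg
  refine ⟨⟨0, fun n x _ => zero_mem _⟩, fun x => ?_⟩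
  have : x = 0 := rfl
  subst this
  simp

/-! ## Graded projective modules are projective -/

/-- The graded free module with a basis element for each homogeneous element `s` of `P`, in the
degree of `s`. -/
noncomputable abbrev GrMod.cover {A : Type u} [Ring A] {𝓐 : ℤ → AddSubgroup A} [GradedRing 𝓐]
    (P : GrMod 𝓐) : GrMod 𝓐 where
  carrier := (Σ i : ℤ, P.deg i) →₀ Aᵐᵒᵖ
  deg n :=
    { carrier := {f | ∀ s, (f s).unop ∈ 𝓐 (n - s.1)}
      zero_mem' := fun s => zero_mem (𝓐 (n - s.1))
      add_mem' := fun hf hg s => add_mem (hf s) (hg s)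
      neg_mem' := fun hf s => neg_mem (hf s) }
  isInternal := by
    classical
    refine isInternal_of_proj _ (fun n => AddMonoidHom.mk' (fun f =>
      Finsupp.onFinset f.support (fun s => MulOpposite.op
        (DirectSum.decompose 𝓐 (f s).unop (n - s.1) : A)) (fun s hs => by
          rw [Finsupp.mem_support_iff]
          intro h0
          exact hs (by simp [h0]))) (fun f g => by
            ext s
            simp [DirectSum.decompose_add])) ?_ ?_ ?_
    · intro i f hf
      ext s
      exact congrArg MulOpposite.op (DirectSum.decompose_of_mem_same 𝓐 (hf s))
    · intro i j h f hf
      ext s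
      have e : j - s.1 ≠ i - s.1 := by omega
      exact congrArg MulOpposite.op (DirectSum.decompose_of_mem_ne 𝓐 (hf s) e)
    · intro f
      induction f using Finsupp.induction_linear with
      | zero => exact zero_mem _
      | add f g hf hg => exact add_mem hf hg
      | single s a =>
        obtain ⟨a, rfl⟩ := MulOpposite.op_surjective a
        induction a using DirectSum.Decomposition.inductionOn 𝓐 with
        | zero => simp
        | @homogeneous i m =>
          refine AddSubgroup.mem_iSup_of_mem (i + s.1) ?_
          intro t
          by_cases h : s = t
          · subst h
            simp
          · simp [Finsupp.single_eq_of_ne' h]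
        | add a b ha hb =>
          rw [MulOpposite.op_add, Finsupp.single_add]
          exact add_mem ha hb
  smul_mem := by
    intro i j f a hf ha s
    have := SetLike.mul_mem_graded (hf s) ha
    have e : i + j - s.1 = i - s.1 + j := by ring
    rw [e]
    simpa using this

theorem GrMod.IsGrProjective.projective {A : Type u} [Ring A] {𝓐 : ℤ → AddSubgroup A}
    [GradedRing 𝓐] {P : GrMod 𝓐} (hP : P.IsGrProjective) : Module.Projective Aᵐᵒᵖ P := by
  let g : GrHom P.cover P :=
    ⟨Finsupp.linearCombination Aᵐᵒᵖ (fun s : Σ i : ℤ, P.deg i => (s.2 : P)), by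
      intro n f hf
      refine sum_mem fun s _ => ?_
      have := P.smul_mem s.2.2 (hf s)
      simpa using this⟩
  have hg : Function.Surjective g.toLin := by
    intro x
    have h : (⨆ i, P.deg i) ≤ g.toLin.toAddMonoidHom.range := by
      refine iSup_le fun i y hy => ?_
      refine ⟨Finsupp.single (⟨i, ⟨y, hy⟩⟩ : Σ i : ℤ, P.deg i) (1 : Aᵐᵒᵖ), ?_⟩
      change Finsupp.linearCombination Aᵐᵒᵖ (fun s : Σ i : ℤ, P.deg i => (s.2 : P)) _ = _
      simp
    exact h (P.mem_iSup_deg x)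
  obtain ⟨h, hh⟩ := hP P.cover P g ⟨LinearMap.id, fun _ _ hx => hx⟩ hg
  have : Module.Projective Aᵐᵒᵖ P.cover :=
    inferInstanceAs (Module.Projective Aᵐᵒᵖ ((Σ i : ℤ, P.deg i) →₀ Aᵐᵒᵖ))
  exact Module.Projective.of_split h.toLin g.toLin (LinearMap.ext hh)

/-! ## The Grothendieck groups -/

/-- Finitely generated projective right `A`-modules. -/
structure FGProj (A : Type u) [Ring A] : Type (u + 1) where
  carrier : Type u
  [addCommGroup : AddCommGroup carrier]
  [module : Module Aᵐᵒᵖ carrier]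
  finite : Module.Finite Aᵐᵒᵖ carrier
  projective : Module.Projective Aᵐᵒᵖ carrier

instance (A : Type u) [Ring A] : CoeSort (FGProj A) (Type u) := ⟨FGProj.carrier⟩

attribute [instance] FGProj.addCommGroup FGProj.module FGProj.finite FGProj.projective

/-- Isomorphism of finitely generated projective modules. -/
instance FGProj.setoid (A : Type u) [Ring A] : Setoid (FGProj A) where
  r P Q := Nonempty (P ≃ₗ[Aᵐᵒᵖ] Q)
  iseqv :=
    { refl := fun _ => ⟨LinearEquiv.refl _ _⟩
      symm := fun ⟨e⟩ => ⟨e.symm⟩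
      trans := fun ⟨e⟩ ⟨f⟩ => ⟨e.trans f⟩ }

/-- The monoid of isomorphism classes of finitely generated projective right `A`-modules. -/
def V (A : Type u) [Ring A] : Type (u + 1) := Quotient (FGProj.setoid A)

/-- The class of `P` in `V A`. -/
def V.mk {A : Type u} [Ring A] (P : FGProj A) : V A := Quotient.mk _ P

/-- The direct sum. -/
abbrev FGProj.prod {A : Type u} [Ring A] (P Q : FGProj A) : FGProj A where
  carrier := P × Q
  finite := inferInstance
  projective := inferInstance

/-- The zero module. -/
abbrev FGProj.zero (A : Type u) [Ring A] : FGProj A where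
  carrier := PUnit
  finite := inferInstance
  projective := inferInstance

/-- Addition in `V A` is `[P] + [Q] = [P ⊕ Q]`. -/
instance (A : Type u) [Ring A] : Add (V A) :=
  ⟨Quotient.map₂ FGProj.prod (fun _ _ ⟨e⟩ _ _ ⟨f⟩ => ⟨e.prodCongr f⟩)⟩

instance (A : Type u) [Ring A] : Zero (V A) := ⟨V.mk (FGProj.zero A)⟩

instance (A : Type u) [Ring A] : AddCommMonoid (V A) where
  add_assoc := by
    rintro ⟨P⟩ ⟨Q⟩ ⟨R⟩
    exact Quotient.sound ⟨LinearEquiv.prodAssoc Aᵐᵒᵖ P Q R⟩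
  zero_add := by
    rintro ⟨P⟩
    exact Quotient.sound ⟨LinearEquiv.uniqueProd⟩
  add_zero := by
    rintro ⟨P⟩
    exact Quotient.sound ⟨LinearEquiv.prodUnique⟩
  add_comm := by
    rintro ⟨P⟩ ⟨Q⟩
    exact Quotient.sound ⟨LinearEquiv.prodComm Aᵐᵒᵖ P Q⟩
  nsmul := nsmulRec

/-- The Grothendieck group `K₀(A)`: the group completion of `V A`. -/
abbrev K0 (A : Type u) [Ring A] : Type (u + 1) := Algebra.GrothendieckAddGroup (V A)

/-- The class `[P]` in `K₀(A)`. -/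
noncomputable def K0.cls {A : Type u} [Ring A] (P : FGProj A) : K0 A :=
  Algebra.GrothendieckAddGroup.of (V.mk P)

/-- Graded finitely generated projective right `A`-modules. -/
structure GrProj {A : Type u} [Ring A] (𝓐 : ℤ → AddSubgroup A) : Type (u + 1) extends
    GrMod 𝓐 where
  finite : Module.Finite Aᵐᵒᵖ carrier
  projective : toGrMod.IsGrProjective

attribute [instance] GrProj.finite

/-- Graded isomorphism of graded finitely generated projective modules. -/
instance GrProj.setoid {A : Type u} [Ring A] (𝓐 : ℤ → AddSubgroup A) : Setoid (GrProj 𝓐) where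
  r P Q := GrIso P.toGrMod Q.toGrMod
  iseqv :=
    { refl := fun P => ⟨LinearEquiv.refl _ _, fun _ _ => Iff.rfl⟩
      symm := fun ⟨e, he⟩ => ⟨e.symm, fun n x => by rw [← he, LinearEquiv.apply_symm_apply]⟩
      trans := fun ⟨e, he⟩ ⟨f, hf⟩ => ⟨e.trans f, fun n x => (hf n (e x)).trans (he n x)⟩ }

/-- The monoid of graded isomorphism classes of graded finitely generated projective modules. -/
def VGr {A : Type u} [Ring A] (𝓐 : ℤ → AddSubgroup A) : Type (u + 1) :=
  Quotient (GrProj.setoid 𝓐)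

/-- The class of `P` in `VGr 𝓐`. -/
def VGr.mk {A : Type u} [Ring A] {𝓐 : ℤ → AddSubgroup A} (P : GrProj 𝓐) : VGr 𝓐 :=
  Quotient.mk _ P

/-- The direct sum. -/
abbrev GrProj.prod {A : Type u} [Ring A] {𝓐 : ℤ → AddSubgroup A} (P Q : GrProj 𝓐) : GrProj 𝓐 where
  toGrMod := P.toGrMod.prod Q.toGrMod
  finite := inferInstanceAs (Module.Finite Aᵐᵒᵖ (P.carrier × Q.carrier))
  projective := P.projective.prod Q.projective

/-- The shift `P(d)`. -/
abbrev GrProj.shift {A : Type u} [Ring A] {𝓐 : ℤ → AddSubgroup A} (P : GrProj 𝓐) (d : ℤ) :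
    GrProj 𝓐 where
  toGrMod := P.toGrMod.shift d
  finite := P.finite
  projective := P.projective.shift d

/-- The zero module. -/
abbrev GrProj.zero {A : Type u} [Ring A] (𝓐 : ℤ → AddSubgroup A) : GrProj 𝓐 where
  toGrMod := GrMod.zero 𝓐
  finite := inferInstanceAs (Module.Finite Aᵐᵒᵖ PUnit.{u + 1})
  projective := GrMod.isGrProjective_zero 𝓐

/-- Addition in `VGr 𝓐` is `[P] + [Q] = [P ⊕ Q]`. -/
instance {A : Type u} [Ring A] (𝓐 : ℤ → AddSubgroup A) : Add (VGr 𝓐) :=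
  ⟨Quotient.map₂ GrProj.prod (fun _ _ ⟨e, he⟩ _ _ ⟨f, hf⟩ =>
    ⟨e.prodCongr f, fun n x => and_congr (he n x.1) (hf n x.2)⟩)⟩

instance {A : Type u} [Ring A] (𝓐 : ℤ → AddSubgroup A) : Zero (VGr 𝓐) :=
  ⟨VGr.mk (GrProj.zero 𝓐)⟩

instance {A : Type u} [Ring A] (𝓐 : ℤ → AddSubgroup A) : AddCommMonoid (VGr 𝓐) where
  add_assoc := by
    rintro ⟨P⟩ ⟨Q⟩ ⟨R⟩
    exact Quotient.sound ⟨LinearEquiv.prodAssoc Aᵐᵒᵖ P.carrier Q.carrier R.carrier,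
      fun n x => and_assoc.symm⟩
  zero_add := by
    rintro ⟨P⟩
    exact Quotient.sound
      ⟨(LinearEquiv.uniqueProd : (PUnit.{u + 1} × P.carrier) ≃ₗ[Aᵐᵒᵖ] P.carrier),
        fun n x => ⟨fun h => ⟨trivial, h⟩, fun h => h.2⟩⟩
  add_zero := by
    rintro ⟨P⟩
    exact Quotient.sound
      ⟨(LinearEquiv.prodUnique : (P.carrier × PUnit.{u + 1}) ≃ₗ[Aᵐᵒᵖ] P.carrier),
        fun n x => ⟨fun h => ⟨h, trivial⟩, fun h => h.1⟩⟩
  add_comm := by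
    rintro ⟨P⟩ ⟨Q⟩
    exact Quotient.sound ⟨LinearEquiv.prodComm Aᵐᵒᵖ P.carrier Q.carrier, fun n x => and_comm⟩
  nsmul := nsmulRec

/-- The graded Grothendieck group `K₀^gr(A)`: the group completion of `VGr 𝓐`. -/
abbrev K0Gr {A : Type u} [Ring A] (𝓐 : ℤ → AddSubgroup A) : Type (u + 1) :=
  Algebra.GrothendieckAddGroup (VGr 𝓐)

/-- The class `[P]` in `K₀^gr(A)`. -/
noncomputable def K0Gr.cls {A : Type u} [Ring A] {𝓐 : ℤ → AddSubgroup A} (P : GrProj 𝓐) :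
    K0Gr 𝓐 :=
  Algebra.GrothendieckAddGroup.of (VGr.mk P)

/-- The subgroup `⟨[P(1)] - [P]⟩` of `K₀^gr(A)`, where `P` runs over all graded finitely generated
projective modules. -/
def K0Gr.shiftSubgroup {A : Type u} [Ring A] (𝓐 : ℤ → AddSubgroup A) : AddSubgroup (K0Gr 𝓐) :=
  AddSubgroup.closure (Set.range fun P : GrProj 𝓐 => K0Gr.cls (P.shift 1) - K0Gr.cls P)

/-- The finitely generated projective module underlying a graded one. -/
def GrProj.forget {A : Type u} [Ring A] {𝓐 : ℤ → AddSubgroup A} [GradedRing 𝓐] (P : GrProj 𝓐) :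
    FGProj A where
  carrier := P.carrier
  finite := P.finite
  projective := P.projective.projective

/-! ## Graded regular and graded Noetherian rings -/

/-- A graded projective resolution `⋯ → P₁ → P₀ → M → 0` in the category of graded right
modules. -/
structure GrProjRes {A : Type u} [Ring A] {𝓐 : ℤ → AddSubgroup A} (M : GrMod 𝓐) :
    Type (u + 1) where
  P : ℕ → GrMod 𝓐
  projective : ∀ k, (P k).IsGrProjective
  d : ∀ k, GrHom (P (k + 1)) (P k)
  aug : GrHom (P 0) M
  aug_surjective : Function.Surjective aug.toLin
  exact_zero : Function.Exact (d 0).toLin aug.toLin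
  exact_succ : ∀ k, Function.Exact (d (k + 1)).toLin (d k).toLin

/-- The resolution has length at most `n`. -/
def GrProjRes.LengthLE {A : Type u} [Ring A] {𝓐 : ℤ → AddSubgroup A} {M : GrMod 𝓐}
    (R : GrProjRes M) (n : ℕ) : Prop :=
  ∀ k, n < k → Subsingleton (R.P k)

/-- The graded projective dimension: the minimal length of a graded projective resolution, and
`⊤` if there is no resolution of finite length. -/
noncomputable def grPdim {A : Type u} [Ring A] {𝓐 : ℤ → AddSubgroup A} (M : GrMod 𝓐) : ℕ∞ :=
  sInf {m : ℕ∞ | ∃ n : ℕ, m = n ∧ ∃ R : GrProjRes M, R.LengthLE n}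

/-- The graded right global dimension. -/
noncomputable def grGlobalDim {A : Type u} [Ring A] (𝓐 : ℤ → AddSubgroup A) : ℕ∞ :=
  ⨆ M : GrMod 𝓐, grPdim M

/-- Graded right regular: the graded right global dimension is finite. -/
def IsGrRightRegular {A : Type u} [Ring A] (𝓐 : ℤ → AddSubgroup A) : Prop :=
  grGlobalDim 𝓐 ≠ ⊤

/-- Graded right Noetherian: ascending chains of graded right ideals become stationary. -/
def IsGrRightNoetherian {A : Type u} [Ring A] (𝓐 : ℤ → AddSubgroup A) [GradedRing 𝓐] : Prop :=
  ∀ I : ℕ →o Submodule Aᵐᵒᵖ A, (∀ n, (I n).IsHomogeneous 𝓐) → ∃ n, ∀ m, n ≤ m → I n = I m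

end GrK

set_option linter.unusedSectionVars false

namespace GrK

/-! ### Graded modules, homogeneous submodules and exact sequences -/

section Basic

variable {A : Type u} [Ring A] {𝓐 : ℤ → AddSubgroup A}

/-! ## Components of graded modules -/

/-! Write K̄ for the quotient of K₀^gr(A) by the classes [P(1)] - [P]. By regularity and the
Noetherian condition, a finitely generated graded module M has a finite resolution by graded
finitely generated projectives (`HasResolution.exists_hasEuler`). Its Euler characteristic χ(M) in
K̄ is well defined by Schanuel's lemma, additive on short exact sequences by the horseshoe lemma
(`IsSES.hasEuler`), and blind to shifts.

The bridge between ungraded and graded modules is P[x, x⁻¹], graded by the exponent of x, where a in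
A_d sends p xⁿ to (pa) xⁿ⁺ᵈ. Setting x = 1 recovers P, and the kernel of this evaluation is the
image of the injective map 1 - x (`exact_oneSub_eval`).

Injectivity: there is a left inverse. Choose a lattice N in P[x, x⁻¹]; then N/xN is a finitely
generated graded A-module. Its class χ(N/xN) does not depend on N (`IsLattice.euler_eq`), because
passing between lattices xN ≤ N' ≤ N replaces N/N' by its translate xN/xN', a shift of it. This
gives an additive map on K₀(A). If P underlies a graded module Q, the lattice generated over A and x
by the elements ∑ qₙ xⁿ has N/xN ≅ Q (`GrProj.grClass_forget`), so the map undoes forgetting.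

Surjectivity: truncating the sequence given by 1 - x and the evaluation yields finitely generated
homogeneous submodules L and L' of P[x, x⁻¹] with 0 → L → L' → P → 0 exact
(`Laurent.exists_window`). The first map is not graded, but the sequence splits over A, so L ⊕ P ≅
L'. An ungraded Schanuel argument on graded resolutions of L and L' shows that [P] is the image of
χ(L') - χ(L) (`HasEuler.cls_sub_cls`). -/

theorem GrMod.induction (M : GrMod 𝓐) {C : M → Prop} (x : M) (hom : ∀ i, ∀ y ∈ M.deg i, C y)
    (add : ∀ y z, C y → C z → C (y + z)) : C x :=
  AddSubgroup.iSup_induction M.deg (C := C) (M.mem_iSup_deg x) hom (hom 0 0 (zero_mem _)) add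

theorem GrMod.proj_mem (M : GrMod 𝓐) (i : ℤ) (x : M) : M.proj i x ∈ M.deg i := by
  induction x using M.induction with
  | hom j y hy =>
    by_cases h : i = j
    · subst h
      rwa [M.proj_same i y hy]
    · rw [M.proj_ne i j h y hy]
      exact zero_mem _
  | add y z hy hz => rw [map_add]; exact add_mem hy hz

theorem GrMod.mem_of_proj_mem (M : GrMod 𝓐) (N : AddSubgroup M) (x : M)
    (h : ∀ i, M.proj i x ∈ N) : x ∈ N := by
  classical
  let _ := M.isInternal.chooseDecomposition
  rw [← DirectSum.sum_support_decompose M.deg x]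
  exact sum_mem fun i _ => h i

theorem GrMod.ext_proj (M : GrMod 𝓐) {x y : M} (h : ∀ i, M.proj i x = M.proj i y) : x = y := by
  rw [← sub_eq_zero, ← AddSubgroup.mem_bot]
  refine M.mem_of_proj_mem _ _ fun i => ?_
  rw [map_sub, h, sub_self]
  exact zero_mem _

theorem GrMod.mem_deg_iff (M : GrMod 𝓐) (i : ℤ) (x : M) : x ∈ M.deg i ↔ M.proj i x = x :=
  ⟨M.proj_same i x, fun h => h ▸ M.proj_mem i x⟩

theorem GrMod.proj_proj_ne (M : GrMod 𝓐) {i j : ℤ} (h : i ≠ j) (x : M) :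
    M.proj i (M.proj j x) = 0 :=
  M.proj_ne i j h _ (M.proj_mem j x)

/-- A map that raises degrees by `d` commutes with the projections. -/
theorem proj_comm {M N : GrMod 𝓐} (φ : M →+ N) (d : ℤ)
    (hφ : ∀ n x, x ∈ M.deg n → φ x ∈ N.deg (n + d)) (n : ℤ) (x : M) :
    N.proj (n + d) (φ x) = φ (M.proj n x) := by
  induction x using M.induction with
  | hom j y hy =>
    by_cases h : n = j
    · subst h
      rw [M.proj_same n y hy, N.proj_same _ _ (hφ _ _ hy)]
    · rw [M.proj_ne n j h y hy, N.proj_ne _ (j + d) (by omega) _ (hφ _ _ hy), map_zero]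
  | add y z hy hz => simp only [map_add, hy, hz]

theorem GrHom.proj_apply {M N : GrMod 𝓐} (f : GrHom M N) (n : ℤ) (x : M) :
    N.proj n (f.toLin x) = f.toLin (M.proj n x) := by
  have := proj_comm f.toLin.toAddMonoidHom 0 (fun n x hx => by simpa using f.map_deg n x hx) n x
  simpa using this

theorem GrMod.proj_smul (M : GrMod 𝓐) {a : A} {d : ℤ} (ha : a ∈ 𝓐 d) (n : ℤ) (x : M) :
    M.proj (n + d) (MulOpposite.op a • x) = MulOpposite.op a • M.proj n x :=
  proj_comm (DistribSMul.toAddMonoidHom M (MulOpposite.op a)) d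
    (fun _ _ hx => M.smul_mem hx ha) n x

/-! ## Graded homomorphisms -/

/-- The identity. -/
def GrHom.id (M : GrMod 𝓐) : GrHom M M := ⟨LinearMap.id, fun _ _ hx => hx⟩

/-- Composition. -/
def GrHom.comp {M N P : GrMod 𝓐} (g : GrHom N P) (f : GrHom M N) : GrHom M P :=
  ⟨g.toLin.comp f.toLin, fun n x hx => g.map_deg n _ (f.map_deg n x hx)⟩

/-- The zero map. -/
def GrHom.zero (M N : GrMod 𝓐) : GrHom M N := ⟨0, fun _ _ _ => zero_mem _⟩

/-- The direct sum of two graded homomorphisms. -/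
def GrHom.prodMap {M N M' N' : GrMod 𝓐} (f : GrHom M N) (g : GrHom M' N') :
    GrHom (M.prod M') (N.prod N') :=
  ⟨f.toLin.prodMap g.toLin, fun n _ hx => ⟨f.map_deg n _ hx.1, g.map_deg n _ hx.2⟩⟩

/-- The map on a direct sum given by maps on the summands. -/
def GrHom.coprod {M M' N : GrMod 𝓐} (f : GrHom M N) (g : GrHom M' N) : GrHom (M.prod M') N :=
  ⟨f.toLin.coprod g.toLin, fun n x hx => by
    change (f.toLin.coprod g.toLin) (x.1, x.2) ∈ _
    rw [LinearMap.coprod_apply]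
    exact add_mem (f.map_deg n _ hx.1) (g.map_deg n _ hx.2)⟩

/-- A graded homomorphism between shifts. -/
def GrHom.shift {M N : GrMod 𝓐} (f : GrHom M N) (d : ℤ) : GrHom (M.shift d) (N.shift d) :=
  ⟨f.toLin, fun n x hx => f.map_deg (d + n) x hx⟩

/-- Each degree is the fixed space of its projection, and `f` commutes with the projections. Hence a
bijective graded homomorphism is automatically a graded isomorphism. -/
theorem GrHom.mem_deg_of_injective {M N : GrMod 𝓐} (f : GrHom M N)
    (hf : Function.Injective f.toLin) (n : ℤ) (x : M) : f.toLin x ∈ N.deg n ↔ x ∈ M.deg n := by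
  rw [N.mem_deg_iff, f.proj_apply, M.mem_deg_iff, hf.eq_iff]

/-- A surjective graded homomorphism is surjective in each degree. -/
theorem GrHom.exists_mem_deg {M N : GrMod 𝓐} (f : GrHom M N)
    (hf : Function.Surjective f.toLin) (n : ℤ) (y : N) (hy : y ∈ N.deg n) :
    ∃ x ∈ M.deg n, f.toLin x = y := by
  obtain ⟨x, rfl⟩ := hf y
  exact ⟨M.proj n x, M.proj_mem n x, by rw [← f.proj_apply, N.proj_same n _ hy]⟩

theorem GrHom.grIso {M N : GrMod 𝓐} (f : GrHom M N) (hf : Function.Bijective f.toLin) :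
    GrIso M N :=
  ⟨LinearEquiv.ofBijective f.toLin hf, f.mem_deg_of_injective hf.1⟩

theorem GrIso.refl (M : GrMod 𝓐) : GrIso M M := ⟨LinearEquiv.refl _ _, fun _ _ => Iff.rfl⟩

theorem GrIso.symm {M N : GrMod 𝓐} : GrIso M N → GrIso N M :=
  fun ⟨e, he⟩ => ⟨e.symm, fun n x => by rw [← he, LinearEquiv.apply_symm_apply]⟩

theorem GrIso.trans {M N P : GrMod 𝓐} : GrIso M N → GrIso N P → GrIso M P :=
  fun ⟨e, he⟩ ⟨f, hf⟩ => ⟨e.trans f, fun n x => (hf n (e x)).trans (he n x)⟩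

theorem GrIso.exists_hom {M N : GrMod 𝓐} :
    GrIso M N → ∃ f : GrHom M N, Function.Bijective f.toLin :=
  fun ⟨e, he⟩ => ⟨⟨e.toLinearMap, fun n x hx => (he n x).2 hx⟩, e.bijective⟩

theorem GrIso.prod {M N M' N' : GrMod 𝓐} :
    GrIso M N → GrIso M' N' → GrIso (M.prod M') (N.prod N') :=
  fun ⟨e, he⟩ ⟨f, hf⟩ => ⟨e.prodCongr f, fun n x => and_congr (he n x.1) (hf n x.2)⟩

theorem GrMod.IsGrProjective.of_retract {P Q : GrMod 𝓐} (hQ : Q.IsGrProjective) (i : GrHom P Q)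
    (r : GrHom Q P) (h : ∀ x, r.toLin (i.toLin x) = x) : P.IsGrProjective := by
  intro M N g j hg
  obtain ⟨k, hk⟩ := hQ M N g (j.comp r) hg
  refine ⟨k.comp i, fun x => (hk (i.toLin x)).trans ?_⟩
  exact congrArg j.toLin (h x)

theorem GrMod.IsGrProjective.of_grIso {P Q : GrMod 𝓐} (hQ : Q.IsGrProjective)
    (h : GrIso P Q) : P.IsGrProjective := by
  obtain ⟨e, he⟩ := h
  exact hQ.of_retract ⟨e.toLinearMap, fun n x hx => (he n x).2 hx⟩
    ⟨e.symm.toLinearMap, fun n x hx => by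
      refine (he n _).1 ?_
      simpa using hx⟩ (fun x => e.symm_apply_apply x)

/-! ## Homogeneous submodules -/

/-- A submodule is homogeneous if it contains the components of its elements. -/
def GrMod.IsHomog (M : GrMod 𝓐) (N : Submodule Aᵐᵒᵖ M) : Prop :=
  ∀ i, ∀ x ∈ N, M.proj i x ∈ N

theorem GrMod.IsHomog.sup {M : GrMod 𝓐} {N N' : Submodule Aᵐᵒᵖ M} (h : M.IsHomog N)
    (h' : M.IsHomog N') : M.IsHomog (N ⊔ N') := by
  intro i x hx
  obtain ⟨y, hy, z, hz, rfl⟩ := Submodule.mem_sup.1 hx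
  rw [map_add]
  exact Submodule.add_mem_sup (h i y hy) (h' i z hz)

theorem GrMod.IsHomog.inf {M : GrMod 𝓐} {N N' : Submodule Aᵐᵒᵖ M} (h : M.IsHomog N)
    (h' : M.IsHomog N') : M.IsHomog (N ⊓ N') :=
  fun i x hx => ⟨h i x hx.1, h' i x hx.2⟩

theorem GrMod.IsHomog.iSup {M : GrMod 𝓐} {ι : Sort*} {N : ι → Submodule Aᵐᵒᵖ M}
    (h : ∀ j, M.IsHomog (N j)) : M.IsHomog (⨆ j, N j) := by
  intro i x hx
  induction hx using Submodule.iSup_induction' with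
  | mem j y hy => exact Submodule.mem_iSup_of_mem j (h j i y hy)
  | zero => rw [map_zero]; exact zero_mem _
  | add y z _ _ hy hz => rw [map_add]; exact add_mem hy hz

theorem GrMod.IsHomog.map {M N : GrMod 𝓐} {S : Submodule Aᵐᵒᵖ M} (h : M.IsHomog S)
    (φ : M →ₗ[Aᵐᵒᵖ] N) (d : ℤ) (hφ : ∀ n x, x ∈ M.deg n → φ x ∈ N.deg (n + d)) :
    N.IsHomog (S.map φ) := by
  rintro i _ ⟨x, hx, rfl⟩
  have := proj_comm φ.toAddMonoidHom d hφ (i - d) x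
  rw [sub_add_cancel] at this
  exact ⟨_, h _ x hx, this.symm⟩

theorem GrMod.IsHomog.comap {M N : GrMod 𝓐} {S : Submodule Aᵐᵒᵖ N} (h : N.IsHomog S)
    (φ : M →ₗ[Aᵐᵒᵖ] N) (d : ℤ) (hφ : ∀ n x, x ∈ M.deg n → φ x ∈ N.deg (n + d)) :
    M.IsHomog (S.comap φ) := by
  intro i x hx
  have := proj_comm φ.toAddMonoidHom d hφ i x
  exact (this ▸ h (i + d) _ hx : φ (M.proj i x) ∈ S)

theorem GrMod.isHomog_top (M : GrMod 𝓐) : M.IsHomog ⊤ := fun _ _ _ => trivial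

theorem GrMod.isHomog_bot (M : GrMod 𝓐) : M.IsHomog ⊥ := fun i x hx => by
  rw [Submodule.mem_bot] at hx ⊢
  rw [hx, map_zero]

theorem GrHom.isHomog_ker {M N : GrMod 𝓐} (f : GrHom M N) : M.IsHomog (LinearMap.ker f.toLin) :=
  N.isHomog_bot.comap f.toLin 0 (fun n x hx => by simpa using f.map_deg n x hx)

theorem GrMod.isHomog_span [GradedRing 𝓐] {M : GrMod 𝓐} {S : Set M}
    (hS : ∀ s ∈ S, ∃ i, s ∈ M.deg i) : M.IsHomog (Submodule.span Aᵐᵒᵖ S) := by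
  intro i x hx
  induction hx using Submodule.span_induction generalizing i with
  | mem s hs =>
    obtain ⟨j, hj⟩ := hS s hs
    by_cases h : i = j
    · subst h
      rw [M.proj_same i s hj]
      exact Submodule.subset_span hs
    · rw [M.proj_ne i j h s hj]
      exact zero_mem _
  | zero => rw [map_zero]; exact zero_mem _
  | add y z _ _ hy hz => rw [map_add]; exact add_mem (hy i) (hz i)
  | smul a y _ hy =>
    obtain ⟨a, rfl⟩ := MulOpposite.op_surjective a
    induction a using DirectSum.Decomposition.inductionOn 𝓐 with
    | zero => simp
    | @homogeneous d m =>
      have := M.proj_smul m.2 (i - d) y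
      rw [sub_add_cancel] at this
      rw [this]
      exact Submodule.smul_mem _ _ (hy _)
    | add a b ha hb =>
      rw [MulOpposite.op_add, add_smul, map_add]
      exact add_mem ha hb

/-- A homogeneous submodule as a graded module. -/
abbrev GrMod.sub (M : GrMod 𝓐) (N : Submodule Aᵐᵒᵖ M) (hN : M.IsHomog N) : GrMod 𝓐 where
  carrier := N
  deg n := (M.deg n).comap N.subtype.toAddMonoidHom
  isInternal := by
    refine isInternal_of_proj _ (fun i => ((M.proj i).comp N.subtype.toAddMonoidHom).codRestrict
      N.toAddSubgroup fun x => hN i x x.2) (fun i x hx => Subtype.ext (M.proj_same i x hx))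
      (fun i j h x hx => Subtype.ext (M.proj_ne i j h x hx)) fun x => ?_
    classical
    let _ := M.isInternal.chooseDecomposition
    have e : x = ∑ i ∈ (DirectSum.decompose M.deg (x : M)).support,
        (⟨M.proj i x, hN i x x.2⟩ : N) := by
      refine Subtype.ext ?_
      rw [AddSubmonoidClass.coe_finsetSum]
      exact (DirectSum.sum_support_decompose M.deg (x : M)).symm
    rw [e]
    exact sum_mem fun i _ => AddSubgroup.mem_iSup_of_mem i (M.proj_mem i x)
  smul_mem := fun hm ha => M.smul_mem hm ha

/-- The inclusion of a homogeneous submodule. -/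
def GrMod.subHom (M : GrMod 𝓐) (N : Submodule Aᵐᵒᵖ M) (hN : M.IsHomog N) : GrHom (M.sub N hN) M :=
  ⟨N.subtype, fun _ _ hx => hx⟩

/-- The quotient by a homogeneous submodule. -/
abbrev GrMod.quot (M : GrMod 𝓐) (N : Submodule Aᵐᵒᵖ M) (hN : M.IsHomog N) : GrMod 𝓐 where
  carrier := M ⧸ N
  deg n := (M.deg n).map N.mkQ.toAddMonoidHom
  isInternal := by
    refine isInternal_of_proj _ (fun i => QuotientAddGroup.map N.toAddSubgroup N.toAddSubgroup
      (M.proj i) fun x hx => hN i x hx) ?_ ?_ ?_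
    · rintro i _ ⟨x, hx, rfl⟩
      exact congrArg N.mkQ (M.proj_same i x hx)
    · rintro i j h _ ⟨x, hx, rfl⟩
      exact (congrArg N.mkQ (M.proj_ne i j h x hx)).trans (map_zero _)
    · intro x
      obtain ⟨x, rfl⟩ := N.mkQ_surjective x
      induction x using M.induction with
      | hom j y hy => exact AddSubgroup.mem_iSup_of_mem j ⟨y, hy, rfl⟩
      | add y z hy hz => rw [map_add]; exact add_mem hy hz
  smul_mem := by
    rintro i j _ a ⟨x, hx, rfl⟩ ha
    exact ⟨MulOpposite.op a • x, M.smul_mem hx ha, map_smul N.mkQ _ _⟩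

/-! ## Short exact sequences -/

/-- A short exact sequence `0 → K → P → M → 0` of graded modules. -/
structure IsSES {K P M : GrMod 𝓐} (f : GrHom K P) (g : GrHom P M) : Prop where
  inj : Function.Injective f.toLin
  exact : Function.Exact f.toLin g.toLin
  surj : Function.Surjective g.toLin

theorem GrHom.isSES_ker {P M : GrMod 𝓐} (g : GrHom P M) (hg : Function.Surjective g.toLin) :
    IsSES (P.subHom _ g.isHomog_ker) g :=
  ⟨Subtype.val_injective, fun x => ⟨fun h => ⟨⟨x, h⟩, rfl⟩, fun ⟨y, hy⟩ => hy ▸ y.2⟩, hg⟩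

theorem IsSES.shift {K P M : GrMod 𝓐} {f : GrHom K P} {g : GrHom P M} (h : IsSES f g) (d : ℤ) :
    IsSES (f.shift d) (g.shift d) :=
  ⟨h.inj, h.exact, h.surj⟩

theorem IsSES.comp_iso {K P M M' : GrMod 𝓐} {f : GrHom K P} {g : GrHom P M} (h : IsSES f g)
    (e : GrHom M M') (he : Function.Bijective e.toLin) : IsSES f (e.comp g) := by
  refine ⟨h.inj, fun x => ?_, he.2.comp h.surj⟩
  rw [← h.exact x]
  exact map_eq_zero_iff e.toLin he.1

theorem GrHom.isSES_zero (M : GrMod 𝓐) : IsSES (GrHom.zero (GrMod.zero 𝓐) M) (GrHom.id M) :=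
  ⟨fun _ _ _ => rfl, fun _ => ⟨fun h => ⟨0, h.symm⟩, fun ⟨_, h⟩ => h.symm⟩,
    fun x => ⟨x, rfl⟩⟩

end Basic

/-! ### Finite generation over a graded right Noetherian ring -/

section Noetherian

variable {A : Type u} [Ring A] {𝓐 : ℤ → AddSubgroup A} [GradedRing 𝓐]

/-! ## Finitely generated graded modules -/

/-- The regular graded module. -/
abbrev GrMod.self (𝓐 : ℤ → AddSubgroup A) [GradedRing 𝓐] : GrMod 𝓐 where
  carrier := A
  deg := 𝓐
  isInternal := DirectSum.Decomposition.isInternal 𝓐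
  smul_mem := fun hm ha => SetLike.mul_mem_graded hm ha

/-- The map `a ↦ m a`. -/
def GrMod.toSpan (M : GrMod 𝓐) (m : M) : A →ₗ[Aᵐᵒᵖ] M where
  toFun a := MulOpposite.op a • m
  map_add' a b := by rw [MulOpposite.op_add, add_smul]
  map_smul' b a := by
    change MulOpposite.op (a * b.unop) • m = b • MulOpposite.op a • m
    rw [MulOpposite.op_mul, mul_smul, MulOpposite.op_unop]

theorem GrMod.toSpan_mem (M : GrMod 𝓐) {m : M} {d : ℤ} (hm : m ∈ M.deg d) (n : ℤ) (a : A)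
    (ha : a ∈ 𝓐 n) : M.toSpan m a ∈ M.deg (n + d) := by
  rw [add_comm]
  exact M.smul_mem hm ha

theorem GrMod.range_toSpan (M : GrMod 𝓐) (m : M) :
    LinearMap.range (M.toSpan m) = Submodule.span Aᵐᵒᵖ {m} := by
  ext x
  rw [Submodule.mem_span_singleton]
  exact ⟨fun ⟨a, h⟩ => ⟨MulOpposite.op a, h⟩, fun ⟨a, h⟩ => ⟨a.unop, h⟩⟩

theorem GrMod.isGrProjective_self : (GrMod.self 𝓐).IsGrProjective := by
  intro M N g j hg
  obtain ⟨y, hy, e⟩ := g.exists_mem_deg hg 0 (j.toLin (1 : A))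
    (j.map_deg 0 _ (SetLike.one_mem_graded 𝓐))
  refine ⟨⟨M.toSpan y, fun n x hx => by simpa using M.toSpan_mem hy n x hx⟩, fun x => ?_⟩
  change g.toLin (MulOpposite.op x • y) = _
  rw [map_smul, e, ← map_smul]
  congr 1
  exact one_mul x

theorem finite_self_op : Module.Finite Aᵐᵒᵖ A :=
  ⟨⟨{1}, eq_top_iff.2 fun a _ => by
    have : MulOpposite.op a • (1 : A) = a := one_mul a
    rw [← this]
    exact Submodule.smul_mem _ _ (Submodule.subset_span (by simp))⟩⟩

/-- The regular graded projective module. -/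
abbrev GrProj.self (𝓐 : ℤ → AddSubgroup A) [GradedRing 𝓐] : GrProj 𝓐 where
  toGrMod := GrMod.self 𝓐
  finite := finite_self_op
  projective := GrMod.isGrProjective_self

/-- A homogeneous finitely generated submodule is spanned by finitely many homogeneous elements. -/
theorem GrMod.exists_finite_homog (M : GrMod 𝓐) (N : Submodule Aᵐᵒᵖ M) (hN : M.IsHomog N)
    (hf : N.FG) : ∃ S : Set M, S.Finite ∧ (∀ s ∈ S, ∃ i, s ∈ M.deg i) ∧
      Submodule.span Aᵐᵒᵖ S = N := by
  classical
  obtain ⟨T, hT⟩ := hf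
  let _ := M.isInternal.chooseDecomposition
  refine ⟨⋃ t ∈ T, ⋃ i ∈ (DirectSum.decompose M.deg t).support, {M.proj i t}, ?_, ?_, ?_⟩
  · exact T.finite_toSet.biUnion fun t _ => Set.Finite.biUnion (Finset.finite_toSet _)
      fun i _ => Set.finite_singleton _
  · intro s hs
    simp only [Set.mem_iUnion, Set.mem_singleton_iff] at hs
    obtain ⟨t, _, i, _, rfl⟩ := hs
    exact ⟨i, M.proj_mem i t⟩
  · refine le_antisymm (Submodule.span_le.2 ?_) ?_
    · intro s hs
      simp only [Set.mem_iUnion, Set.mem_singleton_iff] at hs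
      obtain ⟨t, ht, i, _, rfl⟩ := hs
      exact hN i t (hT ▸ Submodule.subset_span ht)
    · rw [← hT, Submodule.span_le]
      intro t ht
      rw [← DirectSum.sum_support_decompose M.deg t]
      refine sum_mem fun i hi => Submodule.subset_span ?_
      simp only [Set.mem_iUnion, Set.mem_singleton_iff]
      exact ⟨t, ht, i, hi, rfl⟩

/-- A finitely generated graded module is a quotient of a graded finitely generated projective
module. -/
theorem GrMod.exists_cover (M : GrMod 𝓐) (hM : Module.Finite Aᵐᵒᵖ M) :
    ∃ (P : GrProj 𝓐) (g : GrHom P.toGrMod M), Function.Surjective g.toLin := by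
  obtain ⟨S, hS, hom, hspan⟩ := M.exists_finite_homog ⊤ M.isHomog_top hM.1
  -- Covering only the span of `S` makes the claim suitable for induction on `S`.
  suffices ∃ (P : GrProj 𝓐) (g : GrHom P.toGrMod M),
      LinearMap.range g.toLin = Submodule.span Aᵐᵒᵖ S by
    obtain ⟨P, g, h⟩ := this
    exact ⟨P, g, LinearMap.range_eq_top.1 (h.trans hspan)⟩
  clear hspan
  induction S, hS using Set.Finite.induction_on with
  | empty => exact ⟨GrProj.zero 𝓐, GrHom.zero _ _, by simp [GrHom.zero, LinearMap.range_zero]⟩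
  | @insert m S _ _ ih =>
    obtain ⟨P, g, h⟩ := ih fun s hs => hom s (Set.mem_insert_of_mem _ hs)
    obtain ⟨i, hi⟩ := hom m (Set.mem_insert _ _)
    -- The shift by `-i` puts `1 : A` in degree `i`, the degree of its image `m`.
    let φ : GrHom ((GrMod.self 𝓐).shift (-i)) M :=
      ⟨M.toSpan m, fun n x hx => by
        have := M.toSpan_mem hi (-i + n) x hx
        rwa [show -i + n + i = n by ring] at this⟩
    refine ⟨((GrProj.self 𝓐).shift (-i)).prod P, φ.coprod g, ?_⟩
    rw [Submodule.span_insert, ← h, ← M.range_toSpan]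
    exact LinearMap.range_coprod (M.toSpan m) g.toLin

theorem GrMod.proj_self (i : ℤ) (x : A) :
    (GrMod.self 𝓐).proj i x = (DirectSum.decompose 𝓐 x i : A) := by
  induction x using (GrMod.self 𝓐).induction with
  | hom j y hy =>
    by_cases h : i = j
    · subst h
      rw [(GrMod.self 𝓐).proj_same i y hy]
      exact (DirectSum.decompose_of_mem_same 𝓐 hy).symm
    · rw [(GrMod.self 𝓐).proj_ne i j h y hy]
      exact (DirectSum.decompose_of_mem_ne 𝓐 hy (Ne.symm h)).symm
  | add y z hy hz =>
    rw [map_add, hy, hz]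
    change _ = ((DirectSum.decompose 𝓐 ((y : A) + (z : A)) i : 𝓐 i) : A)
    rw [DirectSum.decompose_add]
    rfl

/-- Graded right ideals of a graded right Noetherian ring are finitely generated. -/
theorem IsGrRightNoetherian.fg (h : IsGrRightNoetherian 𝓐) (I : Submodule Aᵐᵒᵖ A)
    (hI : (GrMod.self 𝓐).IsHomog I) : I.FG := by
  classical
  -- The chain condition is available for homogeneous right ideals only, so a maximal finitely
  -- generated subideal of `I` is sought among these. It absorbs every homogeneous component of
  -- every element of `I`.
  let T := {J : Submodule Aᵐᵒᵖ A // (GrMod.self 𝓐).IsHomog J}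
  have wf : WellFoundedGT T := by
    rw [wellFoundedGT_iff_monotone_chain_condition]
    intro f
    obtain ⟨n, hn⟩ := h ⟨fun n => (f n).1, fun a b hab => f.monotone hab⟩ (fun n i x hx => by
      rw [← GrMod.proj_self]
      exact (f n).2 i x hx)
    exact ⟨n, fun m hm => Subtype.ext (hn m hm)⟩
  obtain ⟨J, ⟨hJf, hJI⟩, hmax⟩ := wf.wf.has_min {J : T | J.1.FG ∧ J.1 ≤ I}
    ⟨⟨⊥, (GrMod.self 𝓐).isHomog_bot⟩, Submodule.fg_bot, bot_le⟩
  have : J.1 = I := by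
    refine le_antisymm hJI fun x hx => ?_
    refine (GrMod.self 𝓐).mem_of_proj_mem J.1.toAddSubgroup x fun i => ?_
    set y := (GrMod.self 𝓐).proj i x with hy
    have hspan : (GrMod.self 𝓐).IsHomog (Submodule.span Aᵐᵒᵖ {y}) :=
      GrMod.isHomog_span fun s hs => by
        rw [Set.mem_singleton_iff.1 hs]
        exact ⟨i, (GrMod.self 𝓐).proj_mem i x⟩
    by_contra hyJ
    refine hmax ⟨J.1 ⊔ Submodule.span Aᵐᵒᵖ {y}, J.2.sup hspan⟩
      ⟨hJf.sup (Submodule.fg_span_singleton y), sup_le hJI ?_⟩ ?_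
    · rw [Submodule.span_singleton_le_iff_mem]
      exact hI i x hx
    · refine lt_of_le_of_ne (show J.1 ≤ _ from le_sup_left) fun e => hyJ ?_
      have e' : J.1 = J.1 ⊔ Submodule.span Aᵐᵒᵖ {y} := congrArg Subtype.val e
      change y ∈ J.1
      rw [e']
      exact Submodule.mem_sup_right (Submodule.mem_span_singleton_self y)
  exact this ▸ hJf

/-- Homogeneous submodules of finitely generated graded modules over a graded right Noetherian
ring are finitely generated. -/
theorem IsGrRightNoetherian.fg_of_isHomog (h : IsGrRightNoetherian 𝓐) (M : GrMod 𝓐)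
    (hM : Module.Finite Aᵐᵒᵖ M) (N : Submodule Aᵐᵒᵖ M) (hN : M.IsHomog N) : N.FG := by
  obtain ⟨S, hS, hom, hspan⟩ := M.exists_finite_homog ⊤ M.isHomog_top hM.1
  have hle : N ≤ Submodule.span Aᵐᵒᵖ S := hspan ▸ le_top
  clear hspan
  induction S, hS using Set.Finite.induction_on generalizing N with
  | empty =>
    rw [Submodule.span_empty, le_bot_iff] at hle
    rw [hle]
    exact Submodule.fg_bot
  | @insert m S _ _ ih =>
    have hom' : ∀ s ∈ S, ∃ i, s ∈ M.deg i := fun s hs => hom s (Set.mem_insert_of_mem _ hs)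
    obtain ⟨d, hd⟩ := hom m (Set.mem_insert _ _)
    have hsp := GrMod.isHomog_span hom'
    refine Submodule.fg_of_fg_map_of_fg_inf_ker (Submodule.span Aᵐᵒᵖ S).mkQ ?_ ?_
    -- Modulo the span of `S`, the submodule `N` is the image of the right ideal of all `a` with `m
    -- a ∈ N + span S`. This ideal is homogeneous because `m` is.
    · have hI : (GrMod.self 𝓐).IsHomog ((N ⊔ Submodule.span Aᵐᵒᵖ S).comap (M.toSpan m)) :=
        (hN.sup hsp).comap (M := GrMod.self 𝓐) (M.toSpan m) d (M.toSpan_mem hd)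
      have e : N.map (Submodule.span Aᵐᵒᵖ S).mkQ =
          (((N ⊔ Submodule.span Aᵐᵒᵖ S).comap (M.toSpan m)).map (M.toSpan m)).map
            (Submodule.span Aᵐᵒᵖ S).mkQ := by
        refine le_antisymm ?_ ?_
        · rintro _ ⟨n, hn, rfl⟩
          have := hle hn
          rw [Submodule.span_insert, ← M.range_toSpan] at this
          obtain ⟨_, ⟨a, rfl⟩, s, hs, rfl⟩ := Submodule.mem_sup.1 this
          refine ⟨M.toSpan m a, ⟨a, ?_, rfl⟩, ?_⟩
          · refine Submodule.mem_sup.2 ⟨_, hn, -s, neg_mem hs, ?_⟩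
            exact add_neg_cancel_right _ _
          · rw [map_add, (Submodule.Quotient.mk_eq_zero _).2 hs |> fun h =>
              (h : (Submodule.span Aᵐᵒᵖ S).mkQ s = 0), add_zero]
        · rintro _ ⟨_, ⟨a, ha, rfl⟩, rfl⟩
          obtain ⟨n, hn, s, hs, e⟩ := Submodule.mem_sup.1 ha
          refine ⟨n, hn, ?_⟩
          rw [← e, map_add, (Submodule.Quotient.mk_eq_zero _).2 hs |> fun h =>
              (h : (Submodule.span Aᵐᵒᵖ S).mkQ s = 0), add_zero]
      rw [e]
      exact ((h.fg _ hI).map _).map _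
    · rw [Submodule.ker_mkQ]
      exact ih (N ⊓ Submodule.span Aᵐᵒᵖ S) (hN.inf hsp) hom' inf_le_right

end Noetherian

/-! ## Schanuel's lemma -/

/-- The pair `(f, k)` maps `K × P'` to `P`, and `z.2 - h (f z.1 + k z.2)` lies in `ker g' = range
f'`; together they give `Φ`. The formula is kept in the conclusion because the graded version reads
the degrees off it. No grading is assumed, so the lemma also serves for isomorphisms `e` that do not
preserve degrees. -/
theorem schanuel_linear {R : Type*} [Ring R] {K P M K' P' M' : Type*} [AddCommGroup K]
    [AddCommGroup P] [AddCommGroup M] [AddCommGroup K'] [AddCommGroup P'] [AddCommGroup M']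
    [Module R K] [Module R P] [Module R M] [Module R K'] [Module R P'] [Module R M']
    {f : K →ₗ[R] P} {g : P →ₗ[R] M} {f' : K' →ₗ[R] P'} {g' : P' →ₗ[R] M'}
    (hf : Function.Injective f) (hfg : Function.Exact f g)
    (hf' : Function.Injective f') (hfg' : Function.Exact f' g') (e : M ≃ₗ[R] M')
    (h : P →ₗ[R] P') (k : P' →ₗ[R] P) (hh : ∀ p, g' (h p) = e (g p))
    (hk : ∀ p, e (g (k p)) = g' p) :
    ∃ Φ : (K × P') ≃ₗ[R] (K' × P), ∀ z : K × P',
      f' (Φ z).1 = z.2 - h (f z.1 + k z.2) ∧ (Φ z).2 = f z.1 + k z.2 := by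
  have zero : ∀ x, g (f x) = 0 := fun x => (hfg _).2 ⟨x, rfl⟩
  have zero' : ∀ x, g' (f' x) = 0 := fun x => (hfg' _).2 ⟨x, rfl⟩
  let S : (K × P') →ₗ[R] P := f.coprod k
  have hS : ∀ z, S z = f z.1 + k z.2 := fun z => rfl
  let T : (K × P') →ₗ[R] P' := LinearMap.snd R K P' - h.comp S
  have hT : ∀ z, T z = z.2 - h (f z.1 + k z.2) := fun z => rfl
  have hTr : ∀ z, T z ∈ LinearMap.range f' := fun z => by
    refine (hfg' _).1 ?_
    rw [hT, map_sub, hh, map_add, map_add, zero, map_zero, zero_add, hk, sub_self]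
  let E := LinearEquiv.ofInjective f' hf'
  let Ψ : (K × P') →ₗ[R] (K' × P) := (E.symm.toLinearMap.comp (T.codRestrict _ hTr)).prod S
  have h1 : ∀ z, f' (Ψ z).1 = T z := fun z => by
    have : E (E.symm ((T.codRestrict _ hTr) z)) = (T.codRestrict _ hTr) z :=
      E.apply_symm_apply _
    exact congrArg Subtype.val this
  have h2 : ∀ z, (Ψ z).2 = S z := fun z => rfl
  have hbij : Function.Bijective Ψ := by
    constructor
    · rw [injective_iff_map_eq_zero]
      intro z hz
      have e1 : T z = 0 := by rw [← h1, hz]; exact map_zero f'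
      have e2 : S z = 0 := by rw [← h2, hz]; rfl
      have e3 : z.2 = 0 := by
        rw [hT, ← hS, e2, map_zero, sub_zero] at e1
        exact e1
      rw [hS, e3, map_zero, add_zero] at e2
      exact Prod.ext (hf (e2.trans (map_zero f).symm)) e3
    · rintro ⟨y, p⟩
      -- The formula for `Φ` forces the second coordinate of a preimage of `(y, p)` to be `f' y + h
      -- p`; what is then missing from `p` lies in `ker g`.
      obtain ⟨x, hx⟩ := (hfg (p - k (f' y + h p))).1 (by
        apply e.injective
        rw [map_sub, map_sub, hk, map_add, zero', zero_add, hh, sub_self, map_zero])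
      refine ⟨(x, f' y + h p), ?_⟩
      have e2 : S (x, f' y + h p) = p := by rw [hS, hx, sub_add_cancel]
      refine Prod.ext (hf' ?_) e2
      rw [h1, hT, ← hS, e2, add_sub_cancel_right]
  exact ⟨LinearEquiv.ofBijective Ψ hbij, fun z => ⟨h1 z, h2 z⟩⟩

/-! ### Euler characteristics of graded modules, modulo the shift -/

section Euler

variable {A : Type u} [Ring A] {𝓐 : ℤ → AddSubgroup A}

theorem IsSES.schanuel {K P M K' P' M' : GrMod 𝓐} {f : GrHom K P} {g : GrHom P M}
    {f' : GrHom K' P'} {g' : GrHom P' M'} (h : IsSES f g) (h' : IsSES f' g')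
    (hP : P.IsGrProjective) (hP' : P'.IsGrProjective) (he : GrIso M M') :
    GrIso (K.prod P') (K'.prod P) := by
  obtain ⟨e, he'⟩ := he
  let e1 : GrHom M M' := ⟨e.toLinearMap, fun n x hx => (he' n x).2 hx⟩
  obtain ⟨a, ha⟩ := hP P' M' g' (e1.comp g) h'.surj
  obtain ⟨b, hb⟩ := hP' P M' (e1.comp g) g' (e.surjective.comp h.surj)
  obtain ⟨Φ, hΦ⟩ := schanuel_linear h.inj h.exact h'.inj h'.exact e a.toLin b.toLin ha hb
  refine GrHom.grIso ⟨Φ.toLinearMap, fun n z hz => ?_⟩ Φ.bijective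
  have h2 : f.toLin z.1 + b.toLin z.2 ∈ P.deg n :=
    add_mem (f.map_deg n _ hz.1) (b.map_deg n _ hz.2)
  refine ⟨?_, ?_⟩
  · change (Φ z).1 ∈ K'.deg n
    rw [← f'.mem_deg_of_injective h'.inj, (hΦ z).1]
    exact sub_mem hz.2 (a.map_deg n _ h2)
  · change (Φ z).2 ∈ P.deg n
    rw [(hΦ z).2]
    exact h2

/-- The inclusion of the first summand. -/
def GrHom.inl (M N : GrMod 𝓐) : GrHom M (M.prod N) :=
  ⟨LinearMap.inl Aᵐᵒᵖ M N, fun _ _ hx => ⟨hx, zero_mem _⟩⟩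

theorem exact_prodMap_id {R : Type*} [Ring R] {K P M : Type*} (X : Type*) [AddCommGroup K]
    [AddCommGroup P] [AddCommGroup M] [AddCommGroup X] [Module R K] [Module R P] [Module R M]
    [Module R X] {f : K →ₗ[R] P} {g : P →ₗ[R] M} (h : Function.Exact f g) :
    Function.Exact ((LinearMap.inl R P X).comp f)
      (g.prodMap (LinearMap.id : X →ₗ[R] X)) := by
  rintro ⟨p, x⟩
  constructor
  · intro e
    obtain ⟨y, rfl⟩ := (h p).1 (congrArg Prod.fst e)
    exact ⟨y, Prod.ext rfl (congrArg Prod.snd e).symm⟩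
  · rintro ⟨y, e⟩
    have e1 : f y = p := congrArg Prod.fst e
    have e2 : 0 = x := congrArg Prod.snd e
    exact Prod.ext ((h p).2 ⟨y, e1⟩) e2.symm

/-- Adding a summand to the last two terms does not change the kernel. A stable isomorphism of the
quotients thus becomes an honest one, to which Schanuel's lemma applies. -/
theorem IsSES.prod_id {K P M : GrMod 𝓐} {f : GrHom K P} {g : GrHom P M} (h : IsSES f g)
    (X : GrMod 𝓐) : IsSES ((GrHom.inl P X).comp f) (g.prodMap (GrHom.id X)) :=
  ⟨(LinearMap.inl_injective (R := Aᵐᵒᵖ)).comp h.inj, exact_prodMap_id X h.exact,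
    h.surj.prodMap Function.surjective_id⟩

/-- Schanuel's lemma for stably isomorphic modules. -/
theorem IsSES.schanuel_stable {K P M K' P' M' X Y : GrMod 𝓐} {f : GrHom K P} {g : GrHom P M}
    {f' : GrHom K' P'} {g' : GrHom P' M'} (h : IsSES f g) (h' : IsSES f' g')
    (hP : P.IsGrProjective) (hP' : P'.IsGrProjective) (hX : X.IsGrProjective)
    (hY : Y.IsGrProjective) (he : GrIso (M.prod X) (M'.prod Y)) :
    GrIso (K.prod (P'.prod Y)) (K'.prod (P.prod X)) :=
  (h.prod_id X).schanuel (h'.prod_id Y) (hP.prod hX) (hP'.prod hY) he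

/-! ## Projective dimension -/

/-- The existence of a graded projective resolution of length at most `n`. -/
def HasResolution : ℕ → GrMod 𝓐 → Prop
  | 0, M => M.IsGrProjective
  | n + 1, M => ∃ (K P : GrMod 𝓐) (f : GrHom K P) (g : GrHom P M),
      IsSES f g ∧ P.IsGrProjective ∧ HasResolution n K

/-- The kernel of the augmentation is resolved by the same complex with its first term removed, of
length one less. -/
theorem GrProjRes.hasResolution {n : ℕ} {M : GrMod 𝓐} (R : GrProjRes M) (hR : R.LengthLE n) :
    HasResolution n M := by
  induction n generalizing M with
  | zero =>
    have := hR 1 one_pos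
    refine (R.projective 0).of_grIso (R.aug.grIso ⟨?_, R.aug_surjective⟩).symm
    rw [injective_iff_map_eq_zero]
    intro x hx
    obtain ⟨y, rfl⟩ := (R.exact_zero x).1 hx
    rw [Subsingleton.elim y 0, map_zero]
  | succ n ih =>
    refine ⟨_, _, _, R.aug, R.aug.isSES_ker R.aug_surjective, R.projective 0, ?_⟩
    let d0 : GrHom (R.P 1) ((R.P 0).sub _ R.aug.isHomog_ker) :=
      ⟨(R.d 0).toLin.codRestrict _ fun x => (R.exact_zero _).2 ⟨x, rfl⟩,
        fun n x hx => (R.d 0).map_deg n x hx⟩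
    refine ih
      { P := fun k => R.P (k + 1)
        projective := fun k => R.projective (k + 1)
        d := fun k => R.d (k + 1)
        aug := d0
        aug_surjective := fun ⟨x, hx⟩ => ?_
        exact_zero := fun x => ?_
        exact_succ := fun k => R.exact_succ (k + 1) } fun k hk => hR (k + 1) (by omega)
    · obtain ⟨y, hy⟩ := (R.exact_zero x).1 hx
      exact ⟨y, Subtype.ext hy⟩
    · rw [← R.exact_succ 0 x]
      exact Subtype.ext_iff

theorem IsGrRightRegular.exists_hasResolution (h : IsGrRightRegular 𝓐) (M : GrMod 𝓐) :
    ∃ n, HasResolution n M := by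
  have h1 : grPdim M ≠ ⊤ := fun e =>
    h (top_le_iff.1 (e ▸ le_iSup (fun M : GrMod 𝓐 => grPdim M) M))
  by_contra hn
  refine h1 ?_
  -- The infimum of the empty set in `ℕ∞` is `⊤`, so finite dimension means that a finite resolution
  -- exists.
  rw [grPdim, show {m : ℕ∞ | ∃ n : ℕ, m = n ∧ ∃ R : GrProjRes M, R.LengthLE n} = ∅ from ?_,
    sInf_empty]
  refine Set.eq_empty_of_forall_notMem ?_
  rintro _ ⟨n, _, R, hR⟩
  exact hn ⟨n, R.hasResolution hR⟩

/-! ## Classes modulo the shift -/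

variable (𝓐) in
/-- The quotient of `K₀^gr(A)` by the subgroup generated by the `[P(1)] - [P]`. -/
abbrev KBar : Type (u + 1) := K0Gr 𝓐 ⧸ K0Gr.shiftSubgroup 𝓐

/-- The class of `P` in `K₀^gr(A) / ⟨[P(1)] - [P]⟩`. -/
noncomputable def GrProj.bar (P : GrProj 𝓐) : KBar 𝓐 := QuotientAddGroup.mk (K0Gr.cls P)

theorem GrProj.bar_congr {P Q : GrProj 𝓐} (h : GrIso P.toGrMod Q.toGrMod) : P.bar = Q.bar :=
  congrArg (fun v => (QuotientAddGroup.mk (Algebra.GrothendieckAddGroup.of v) : KBar 𝓐))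
    (Quotient.sound h : VGr.mk P = VGr.mk Q)

theorem GrProj.bar_prod (P Q : GrProj 𝓐) : (P.prod Q).bar = P.bar + Q.bar := by
  have : K0Gr.cls (P.prod Q) = K0Gr.cls P + K0Gr.cls Q :=
    map_add (Algebra.GrothendieckAddGroup.of (M := VGr 𝓐)) (VGr.mk P) (VGr.mk Q)
  rw [bar, this]
  rfl

theorem GrProj.bar_zero : (GrProj.zero 𝓐).bar = 0 := by
  have : K0Gr.cls (GrProj.zero 𝓐) = 0 :=
    map_zero (Algebra.GrothendieckAddGroup.of (M := VGr 𝓐))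
  rw [bar, this]
  rfl

theorem GrProj.bar_shift_one (P : GrProj 𝓐) : (P.shift 1).bar = P.bar := by
  refine (QuotientAddGroup.eq_iff_sub_mem).2 ?_
  exact AddSubgroup.subset_closure ⟨P, rfl⟩

theorem GrMod.grIso_shift_shift (M : GrMod 𝓐) (d e : ℤ) :
    GrIso ((M.shift d).shift e) (M.shift (d + e)) :=
  ⟨LinearEquiv.refl Aᵐᵒᵖ M, fun n x => by
    change x ∈ M.deg (d + e + n) ↔ x ∈ M.deg (d + (e + n))
    rw [add_assoc]⟩

theorem GrMod.grIso_shift_zero (M : GrMod 𝓐) : GrIso (M.shift 0) M :=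
  ⟨LinearEquiv.refl Aᵐᵒᵖ M, fun n x => by
    change x ∈ M.deg n ↔ x ∈ M.deg (0 + n)
    rw [zero_add]⟩

theorem GrProj.bar_shift (P : GrProj 𝓐) (d : ℤ) : (P.shift d).bar = P.bar := by
  have step : ∀ d : ℤ, (P.shift (d + 1)).bar = (P.shift d).bar := fun d => by
    rw [← (P.shift d).bar_shift_one]
    exact (bar_congr (P.toGrMod.grIso_shift_shift d 1)).symm
  induction d using Int.induction_on with
  | zero => exact bar_congr P.toGrMod.grIso_shift_zero
  | succ n ih => rw [step, ih]
  | pred n ih => rw [← ih, ← step, sub_add_cancel]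

/-! ## Euler characteristics -/

/-- `HasEuler n M c`: the module `M` has a resolution of length at most `n` by graded finitely
generated projective modules, and `c` is its Euler characteristic. -/
def HasEuler : ℕ → GrMod 𝓐 → KBar 𝓐 → Prop
  | 0, M, c => ∃ P : GrProj 𝓐, GrIso P.toGrMod M ∧ c = P.bar
  | n + 1, M, c => ∃ (K : GrMod 𝓐) (P : GrProj 𝓐) (f : GrHom K P.toGrMod)
      (g : GrHom P.toGrMod M) (c' : KBar 𝓐), IsSES f g ∧ HasEuler n K c' ∧ c = P.bar - c'

theorem HasEuler.congr {n : ℕ} {M M' : GrMod 𝓐} {c : KBar 𝓐} (h : HasEuler n M c)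
    (e : GrIso M M') : HasEuler n M' c := by
  cases n with
  | zero =>
    obtain ⟨P, hP, rfl⟩ := h
    exact ⟨P, hP.trans e, rfl⟩
  | succ n =>
    obtain ⟨K, P, f, g, c', hs, hK, rfl⟩ := h
    obtain ⟨φ, hφ⟩ := e.exists_hom
    exact ⟨K, P, f, φ.comp g, c', hs.comp_iso φ hφ, hK, rfl⟩

/-- A resolution may be prolonged by the zero module, so that resolutions of different lengths can
be compared at a common `n`. -/
theorem HasEuler.succ {n : ℕ} {M : GrMod 𝓐} {c : KBar 𝓐} (h : HasEuler n M c) :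
    HasEuler (n + 1) M c := by
  induction n generalizing M c with
  | zero =>
    obtain ⟨P, hP, rfl⟩ := h
    obtain ⟨φ, hφ⟩ := hP.exists_hom
    exact ⟨GrMod.zero 𝓐, P, _, φ.comp (GrHom.id _), 0, (GrHom.isSES_zero P.toGrMod).comp_iso φ hφ,
      ⟨GrProj.zero 𝓐, GrIso.refl _, GrProj.bar_zero.symm⟩, (sub_zero _).symm⟩
  | succ n ih =>
    obtain ⟨K, P, f, g, c', hs, hK, rfl⟩ := h
    exact ⟨K, P, f, g, c', hs, ih hK, rfl⟩

theorem HasEuler.mono {n m : ℕ} (hnm : n ≤ m) {M : GrMod 𝓐} {c : KBar 𝓐} (h : HasEuler n M c) :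
    HasEuler m M c :=
  Nat.le_induction h (fun _ _ => HasEuler.succ) m hnm

theorem HasEuler.shift {n : ℕ} {M : GrMod 𝓐} {c : KBar 𝓐} (h : HasEuler n M c) (d : ℤ) :
    HasEuler n (M.shift d) c := by
  induction n generalizing M c with
  | zero =>
    obtain ⟨P, ⟨e, he⟩, rfl⟩ := h
    exact ⟨P.shift d, ⟨e, fun n x => he (d + n) x⟩, (P.bar_shift d).symm⟩
  | succ n ih =>
    obtain ⟨K, P, f, g, c', hs, hK, rfl⟩ := h
    exact ⟨K.shift d, P.shift d, f.shift d, g.shift d, c', hs.shift d, ih hK, by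
      rw [P.bar_shift]⟩

/-- Euler characteristics agree up to the difference of the stabilizing projective modules. -/
theorem HasEuler.stable_unique {n : ℕ} {M M' : GrMod 𝓐} {c c' : KBar 𝓐} (h : HasEuler n M c)
    (h' : HasEuler n M' c') (X Y : GrProj 𝓐)
    (e : GrIso (M.prod X.toGrMod) (M'.prod Y.toGrMod)) : c + X.bar = c' + Y.bar := by
  induction n generalizing M M' c c' X Y with
  | zero =>
    obtain ⟨P, hP, rfl⟩ := h
    obtain ⟨P', hP', rfl⟩ := h'
    rw [← GrProj.bar_prod, ← GrProj.bar_prod]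
    exact GrProj.bar_congr
      (((hP.prod (GrIso.refl _)).trans e).trans (hP'.prod (GrIso.refl _)).symm)
  | succ n ih =>
    obtain ⟨K, P, f, g, d, hs, hK, rfl⟩ := h
    obtain ⟨K', P', f', g', d', hs', hK', rfl⟩ := h'
    -- Schanuel's lemma makes the syzygies isomorphic only after adding `P' ⊕ Y` and `P ⊕ X`, hence
    -- the stabilizing modules must vary in the induction.
    have := ih hK hK' (P'.prod Y) (P.prod X)
      (hs.schanuel_stable hs' P.projective P'.projective X.projective Y.projective e)
    rw [GrProj.bar_prod, GrProj.bar_prod] at this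
    rw [sub_add_eq_add_sub, sub_add_eq_add_sub, sub_eq_sub_iff_add_eq_add, add_comm _ d',
      add_comm _ d]
    exact this.symm

theorem HasEuler.unique {n m : ℕ} {M : GrMod 𝓐} {c c' : KBar 𝓐} (h : HasEuler n M c)
    (h' : HasEuler m M c') : c = c' :=
  add_right_cancel ((h.mono (le_max_left n m)).stable_unique (h'.mono (le_max_right n m))
    (GrProj.zero 𝓐) (GrProj.zero 𝓐) (GrIso.refl _))

/-- This is the horseshoe lemma. Lifting the cover of `M''` through `g` gives a cover of `M` by `P'
⊕ P''`, and its kernel is an extension of `K''` by `K'`, to which the induction applies. In length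
zero the sequence splits. -/
theorem IsSES.hasEuler {n : ℕ} {M' M M'' : GrMod 𝓐} {f : GrHom M' M} {g : GrHom M M''}
    {c' c'' : KBar 𝓐} (hs : IsSES f g) (h' : HasEuler n M' c') (h'' : HasEuler n M'' c'') :
    HasEuler n M (c' + c'') := by
  induction n generalizing M' M M'' c' c'' with
  | zero =>
    obtain ⟨P', hP', rfl⟩ := h'
    obtain ⟨P'', hP'', rfl⟩ := h''
    obtain ⟨a, ha⟩ := hP'.exists_hom
    obtain ⟨b, hb⟩ := hP''.exists_hom
    obtain ⟨s, hs'⟩ := P''.projective M M'' g b hs.surj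
    refine ⟨P'.prod P'', ((f.comp a).coprod s).grIso ⟨?_, ?_⟩, (GrProj.bar_prod _ _).symm⟩
    · rw [injective_iff_map_eq_zero]
      rintro ⟨x, y⟩ hxy
      have e : f.toLin (a.toLin x) + s.toLin y = 0 := hxy
      have ey : y = 0 := by
        refine hb.1 ?_
        rw [← hs', eq_neg_of_add_eq_zero_right e, map_neg, (hs.exact _).2 ⟨_, rfl⟩, map_zero,
          neg_zero]
      rw [ey, map_zero, add_zero] at e
      have ex : x = 0 := ha.1 (hs.inj (by rw [e, map_zero, map_zero]))
      exact Prod.ext ex ey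
    · intro m
      obtain ⟨y, hy⟩ := hb.2 (g.toLin m)
      obtain ⟨z, hz⟩ := (hs.exact (m - s.toLin y)).1 (by rw [map_sub, hs', hy, sub_self])
      obtain ⟨x, rfl⟩ := ha.2 z
      refine ⟨(x, y), ?_⟩
      change f.toLin (a.toLin x) + s.toLin y = m
      rw [hz, sub_add_cancel]
  | succ n ih =>
    obtain ⟨K', P', i', p', d', hs', hK', rfl⟩ := h'
    obtain ⟨K'', P'', i'', p'', d'', hs'', hK'', rfl⟩ := h''
    obtain ⟨s, hsg⟩ := P''.projective M M'' g p'' hs.surj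
    let q : GrHom (P'.prod P'').toGrMod M := (f.comp p').coprod s
    have hq : ∀ x y, q.toLin (x, y) = f.toLin (p'.toLin x) + s.toLin y := fun _ _ => rfl
    have hgq : ∀ x y, g.toLin (q.toLin (x, y)) = p''.toLin y := fun x y => by
      rw [hq, map_add, (hs.exact _).2 ⟨_, rfl⟩, zero_add, hsg]
    have hqs : Function.Surjective q.toLin := fun m => by
      obtain ⟨y, hy⟩ := hs''.surj (g.toLin m)
      obtain ⟨z, hz⟩ := (hs.exact (m - s.toLin y)).1 (by rw [map_sub, hsg, hy, sub_self])
      obtain ⟨x, rfl⟩ := hs'.surj z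
      exact ⟨(x, y), by rw [hq, hz, sub_add_cancel]⟩
    have hz' : ∀ x, p'.toLin (i'.toLin x) = 0 := fun x => (hs'.exact _).2 ⟨x, rfl⟩
    let a : GrHom K' ((P'.prod P'').toGrMod.sub _ q.isHomog_ker) :=
      ⟨((LinearMap.inl Aᵐᵒᵖ P'.carrier P''.carrier).comp i'.toLin).codRestrict _ fun x => by
        change q.toLin (i'.toLin x, 0) = 0
        rw [hq, hz', map_zero, map_zero, add_zero], fun n x hx =>
          ⟨i'.map_deg n x hx, zero_mem _⟩⟩
    have hbmem : ∀ z : LinearMap.ker q.toLin, z.1.2 ∈ LinearMap.range i''.toLin := fun z => by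
      refine (hs''.exact _).1 ?_
      have hz : q.toLin (z.1.1, z.1.2) = 0 := z.2
      rw [← hgq z.1.1, hz, map_zero]
    let E := LinearEquiv.ofInjective i''.toLin hs''.inj
    let β : LinearMap.ker q.toLin →ₗ[Aᵐᵒᵖ] K'' := E.symm.toLinearMap.comp
      (((LinearMap.snd Aᵐᵒᵖ P'.carrier P''.carrier).comp
        (LinearMap.ker q.toLin).subtype).codRestrict _ hbmem)
    have hβ : ∀ z, i''.toLin (β z) = z.1.2 := fun z =>
      congrArg Subtype.val (E.apply_symm_apply ⟨z.1.2, hbmem z⟩)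
    let b : GrHom ((P'.prod P'').toGrMod.sub _ q.isHomog_ker) K'' :=
      ⟨β, fun n z hz => by
        rw [← i''.mem_deg_of_injective hs''.inj, hβ]
        exact hz.2⟩
    have hab : IsSES a b := by
      refine ⟨fun x y hxy => ?_, fun z => ⟨fun hz => ?_, ?_⟩, fun y => ?_⟩
      · exact hs'.inj (congrArg (fun w => (Subtype.val w).1) hxy)
      · have h2 : z.1.2 = 0 := by
          rw [← hβ]
          exact (congrArg i''.toLin hz).trans (map_zero _)
        have h3 : q.toLin (z.1.1, z.1.2) = 0 := z.2
        rw [h2, hq, map_zero, add_zero] at h3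
        obtain ⟨x, hx⟩ := (hs'.exact z.1.1).1 (hs.inj (h3.trans (map_zero _).symm))
        exact ⟨x, Subtype.ext (Prod.ext hx h2.symm)⟩
      · rintro ⟨x, rfl⟩
        exact hs''.inj ((hβ _).trans (map_zero _).symm)
      -- Since `g` kills `s (i'' y)`, this element comes from some `x` in `P'`, and `(-x, i'' y)` is
      -- a preimage of `y` in the kernel of `q`.
      · obtain ⟨z, hz⟩ := (hs.exact (s.toLin (i''.toLin y))).1
          (by rw [hsg]; exact (hs''.exact _).2 ⟨y, rfl⟩)
        obtain ⟨x, rfl⟩ := hs'.surj z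
        refine ⟨⟨(-x, i''.toLin y), ?_⟩, hs''.inj (hβ _)⟩
        change q.toLin (-x, i''.toLin y) = 0
        rw [hq, map_neg, map_neg, hz, neg_add_cancel]
    refine ⟨_, P'.prod P'', _, q, d' + d'', q.isSES_ker hqs, ih hab hK' hK'', ?_⟩
    rw [GrProj.bar_prod, add_sub_add_comm]

/-! ## The Euler characteristic of a finitely generated module -/

/-- The modules in the resolution of `L` may be infinitely generated. A finitely generated cover of
`M` has a finitely generated kernel by the Noetherian condition, and by Schanuel's lemma this kernel
is stably isomorphic to the syzygy of `L`. Stable isomorphism, with arbitrary projective `X` and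
`Y`, is what passes through the induction. -/
theorem HasResolution.exists_hasEuler [GradedRing 𝓐] (hnoeth : IsGrRightNoetherian 𝓐) {n : ℕ}
    {L M X Y : GrMod 𝓐} (hL : HasResolution n L) (hX : X.IsGrProjective) (hY : Y.IsGrProjective)
    (e : GrIso (M.prod X) (L.prod Y)) (hM : Module.Finite Aᵐᵒᵖ M) : ∃ c, HasEuler n M c := by
  induction n generalizing L M X Y with
  | zero =>
    have h1 : (M.prod X).IsGrProjective := (GrMod.IsGrProjective.prod hL hY).of_grIso e
    have h2 : M.IsGrProjective := h1.of_retract (GrHom.inl M X)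
      ⟨LinearMap.fst Aᵐᵒᵖ M X, fun _ _ hx => hx.1⟩ fun _ => rfl
    exact ⟨_, ⟨M, hM, h2⟩, GrIso.refl _, rfl⟩
  | succ n ih =>
    obtain ⟨K, P, f, g, hs, hP, hK⟩ := hL
    obtain ⟨F, q, hq⟩ := M.exists_cover hM
    have hfin : Module.Finite Aᵐᵒᵖ (LinearMap.ker q.toLin) :=
      Module.Finite.iff_fg.2 (hnoeth.fg_of_isHomog F.toGrMod F.finite _ q.isHomog_ker)
    obtain ⟨c, hc⟩ := ih hK (hP.prod hY) (F.projective.prod hX)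
      ((q.isSES_ker hq).schanuel_stable hs F.projective hP hX hY e) hfin
    exact ⟨_, _, F, _, q, c, q.isSES_ker hq, hc, rfl⟩

variable (𝓐) in
/-- Every finitely generated graded module has a finite resolution by graded finitely generated
projective modules. -/
def HasFiniteResolutions : Prop :=
  ∀ M : GrMod 𝓐, Module.Finite Aᵐᵒᵖ M → ∃ n c, HasEuler n M c

theorem hasFiniteResolutions [GradedRing 𝓐] (hreg : IsGrRightRegular 𝓐)
    (hnoeth : IsGrRightNoetherian 𝓐) : HasFiniteResolutions 𝓐 := by
  intro M hM
  obtain ⟨n, hn⟩ := hreg.exists_hasResolution M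
  exact ⟨n, hn.exists_hasEuler hnoeth (GrMod.isGrProjective_zero 𝓐)
    (GrMod.isGrProjective_zero 𝓐) (GrIso.refl _) hM⟩

open Classical in
/-- The Euler characteristic of a graded module that has a finite resolution by graded finitely
generated projective modules. -/
noncomputable def euler (M : GrMod 𝓐) : KBar 𝓐 :=
  -- Under `HasFiniteResolutions` the default value is never taken on finitely generated modules.
  if h : ∃ c, ∃ n, HasEuler n M c then h.choose else 0

theorem HasEuler.euler_eq {n : ℕ} {M : GrMod 𝓐} {c : KBar 𝓐} (h : HasEuler n M c) :
    euler M = c := by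
  have hex : ∃ c, ∃ n, HasEuler n M c := ⟨c, n, h⟩
  rw [euler, dif_pos hex]
  exact hex.choose_spec.choose_spec.unique h

theorem HasFiniteResolutions.exists_hasEuler (H : HasFiniteResolutions 𝓐) (M : GrMod 𝓐)
    (hM : Module.Finite Aᵐᵒᵖ M) : ∃ n, HasEuler n M (euler M) := by
  obtain ⟨n, c, h⟩ := H M hM
  exact ⟨n, h.euler_eq ▸ h⟩

theorem euler_proj (P : GrProj 𝓐) : euler P.toGrMod = P.bar :=
  HasEuler.euler_eq (n := 0) ⟨P, GrIso.refl _, rfl⟩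

theorem HasFiniteResolutions.euler_congr (H : HasFiniteResolutions 𝓐) {M M' : GrMod 𝓐}
    (hM : Module.Finite Aᵐᵒᵖ M) (f : GrHom M M') (hf : Function.Bijective f.toLin) :
    euler M = euler M' := by
  obtain ⟨n, h⟩ := H.exists_hasEuler M hM
  exact (h.congr (f.grIso hf)).euler_eq.symm

theorem HasFiniteResolutions.euler_shift (H : HasFiniteResolutions 𝓐) {M : GrMod 𝓐}
    (hM : Module.Finite Aᵐᵒᵖ M) (d : ℤ) : euler (M.shift d) = euler M := by
  obtain ⟨n, h⟩ := H.exists_hasEuler M hM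
  exact (h.shift d).euler_eq

theorem HasFiniteResolutions.euler_add (H : HasFiniteResolutions 𝓐) {M' M M'' : GrMod 𝓐}
    {f : GrHom M' M} {g : GrHom M M''} (hs : IsSES f g) (h' : Module.Finite Aᵐᵒᵖ M')
    (h'' : Module.Finite Aᵐᵒᵖ M'') : euler M = euler M' + euler M'' := by
  obtain ⟨n, hn⟩ := H.exists_hasEuler M' h'
  obtain ⟨m, hm⟩ := H.exists_hasEuler M'' h''
  exact (hs.hasEuler (hn.mono (le_max_left n m)) (hm.mono (le_max_right n m))).euler_eq

end Euler

/-! ### Lattices for a translation of degree one, and the class of N/xN -/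

section Lattice

variable {A : Type u} [Ring A] {𝓐 : ℤ → AddSubgroup A}

/-! ## Subquotients -/

/-- The subquotient `N / (N ∩ L)` of a graded module. -/
abbrev GrMod.subq (U : GrMod 𝓐) {N L : Submodule Aᵐᵒᵖ U} (hN : U.IsHomog N) (hL : U.IsHomog L) :
    GrMod 𝓐 :=
  (U.sub N hN).quot (L.comap N.subtype)
    (GrMod.IsHomog.comap (M := U.sub N hN) hL N.subtype 0 fun n x hx => by
      rw [add_zero]
      exact hx)

/-- The class of an element of `N` in `N / (N ∩ L)`. -/
def subqMk {U : GrMod 𝓐} {N L : Submodule Aᵐᵒᵖ U} (hN : U.IsHomog N) (hL : U.IsHomog L) :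
    N →ₗ[Aᵐᵒᵖ] U.subq hN hL :=
  (L.comap N.subtype).mkQ

theorem subqMk_surjective {U : GrMod 𝓐} {N L : Submodule Aᵐᵒᵖ U} (hN : U.IsHomog N)
    (hL : U.IsHomog L) : Function.Surjective (subqMk hN hL) :=
  Submodule.mkQ_surjective _

theorem subqMk_eq_zero {U : GrMod 𝓐} {N L : Submodule Aᵐᵒᵖ U} (hN : U.IsHomog N)
    (hL : U.IsHomog L) (x : N) : subqMk hN hL x = 0 ↔ (x : U) ∈ L :=
  Submodule.Quotient.mk_eq_zero _

theorem finite_subq {U : GrMod 𝓐} {N L : Submodule Aᵐᵒᵖ U} (hN : U.IsHomog N) (hL : U.IsHomog L)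
    (S : Submodule Aᵐᵒᵖ U) (hS : S.FG) (hSN : S ≤ N) (hle : N ≤ S ⊔ L) :
    Module.Finite Aᵐᵒᵖ (U.subq hN hL) := by
  have : Module.Finite Aᵐᵒᵖ S := Module.Finite.iff_fg.2 hS
  refine Module.Finite.of_surjective ((subqMk hN hL).comp (Submodule.inclusion hSN)) fun y => ?_
  obtain ⟨⟨x, hx⟩, rfl⟩ := subqMk_surjective hN hL y
  obtain ⟨s, hs, l, hl, rfl⟩ := Submodule.mem_sup.1 (hle hx)
  refine ⟨⟨s, hs⟩, ?_⟩
  rw [LinearMap.comp_apply, ← sub_eq_zero, ← map_sub, subqMk_eq_zero]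
  have : s - (s + l) = -l := by abel
  change s - (s + l) ∈ L
  rw [this]
  exact neg_mem hl

section Map

variable {U U' : GrMod 𝓐} {N L : Submodule Aᵐᵒᵖ U} {N' L' : Submodule Aᵐᵒᵖ U'}
  (hN : U.IsHomog N) (hL : U.IsHomog L) (hN' : U'.IsHomog N') (hL' : U'.IsHomog L')
  (φ : U →ₗ[Aᵐᵒᵖ] U') (h : ∀ x ∈ N, φ x ∈ N') (h' : ∀ x ∈ L, φ x ∈ L')

/-- The map induced on subquotients. -/
def subqMap : U.subq hN hL →ₗ[Aᵐᵒᵖ] U'.subq hN' hL' :=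
  Submodule.mapQ _ _ (φ.restrict h) fun x hx => h' x hx

theorem subqMap_mk (x : N) : subqMap hN hL hN' hL' φ h h' (subqMk hN hL x) =
    subqMk hN' hL' ⟨φ x, h x x.2⟩ := rfl

theorem subqMap_deg (d : ℤ) (hφ : ∀ n x, x ∈ U.deg n → φ x ∈ U'.deg (n + d)) (n : ℤ)
    (x : U.subq hN hL) (hx : x ∈ (U.subq hN hL).deg n) :
    subqMap hN hL hN' hL' φ h h' x ∈ (U'.subq hN' hL').deg (n + d) := by
  obtain ⟨y, hy, rfl⟩ := hx
  exact ⟨⟨φ y, h y y.2⟩, hφ n y hy, rfl⟩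

theorem subqMap_injective (hinj : ∀ x ∈ N, φ x ∈ L' → x ∈ L) :
    Function.Injective (subqMap hN hL hN' hL' φ h h') := by
  rw [injective_iff_map_eq_zero]
  intro y hy
  obtain ⟨x, rfl⟩ := subqMk_surjective hN hL y
  rw [subqMap_mk, subqMk_eq_zero] at hy
  rw [subqMk_eq_zero]
  exact hinj x x.2 hy

theorem subqMap_surjective (hsurj : ∀ y ∈ N', ∃ x ∈ N, y - φ x ∈ L') :
    Function.Surjective (subqMap hN hL hN' hL' φ h h') := by
  intro y
  obtain ⟨y, rfl⟩ := subqMk_surjective hN' hL' y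
  obtain ⟨x, hx, hxy⟩ := hsurj y y.2
  refine ⟨subqMk hN hL ⟨x, hx⟩, ?_⟩
  rw [subqMap_mk, eq_comm, ← sub_eq_zero, ← map_sub, subqMk_eq_zero]
  exact hxy

end Map

/-- The elementwise criterion covers both the third isomorphism theorem and the associated graded
module of a direct sum of lattices. -/
theorem isSES_subq {U₁ U U₂ : GrMod 𝓐} {N₁ L₁ : Submodule Aᵐᵒᵖ U₁} {N L : Submodule Aᵐᵒᵖ U}
    {N₂ L₂ : Submodule Aᵐᵒᵖ U₂} (hN₁ : U₁.IsHomog N₁) (hL₁ : U₁.IsHomog L₁) (hN : U.IsHomog N)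
    (hL : U.IsHomog L) (hN₂ : U₂.IsHomog N₂) (hL₂ : U₂.IsHomog L₂) (f : GrHom U₁ U)
    (g : GrHom U U₂) (hf : ∀ x ∈ N₁, f.toLin x ∈ N) (hf' : ∀ x ∈ L₁, f.toLin x ∈ L)
    (hg : ∀ x ∈ N, g.toLin x ∈ N₂) (hg' : ∀ x ∈ L, g.toLin x ∈ L₂)
    (hinj : ∀ x ∈ N₁, f.toLin x ∈ L → x ∈ L₁)
    (hzero : ∀ x ∈ N₁, g.toLin (f.toLin x) ∈ L₂)
    (hex : ∀ y ∈ N, g.toLin y ∈ L₂ → ∃ x ∈ N₁, y - f.toLin x ∈ L)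
    (hsurj : ∀ y ∈ N₂, ∃ x ∈ N, y - g.toLin x ∈ L₂) :
    ∃ (a : GrHom (U₁.subq hN₁ hL₁) (U.subq hN hL)) (b : GrHom (U.subq hN hL) (U₂.subq hN₂ hL₂)),
      IsSES a b := by
  refine ⟨⟨subqMap hN₁ hL₁ hN hL f.toLin hf hf', fun n x hx => ?_⟩,
    ⟨subqMap hN hL hN₂ hL₂ g.toLin hg hg', fun n x hx => ?_⟩,
    subqMap_injective hN₁ hL₁ hN hL f.toLin hf hf' hinj, fun y => ⟨fun hy => ?_, ?_⟩,
    subqMap_surjective hN hL hN₂ hL₂ g.toLin hg hg' hsurj⟩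
  · have := subqMap_deg hN₁ hL₁ hN hL f.toLin hf hf' 0
      (fun n x hx => by rw [add_zero]; exact f.map_deg n x hx) n x hx
    rwa [add_zero] at this
  · have := subqMap_deg hN hL hN₂ hL₂ g.toLin hg hg' 0
      (fun n x hx => by rw [add_zero]; exact g.map_deg n x hx) n x hx
    rwa [add_zero] at this
  · obtain ⟨y, rfl⟩ := subqMk_surjective hN hL y
    change subqMap hN hL hN₂ hL₂ g.toLin hg hg' _ = 0 at hy
    rw [subqMap_mk, subqMk_eq_zero] at hy
    obtain ⟨x, hx, hxy⟩ := hex y y.2 hy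
    refine ⟨subqMk hN₁ hL₁ ⟨x, hx⟩, ?_⟩
    change subqMap hN₁ hL₁ hN hL f.toLin hf hf' _ = _
    rw [subqMap_mk, eq_comm, ← sub_eq_zero, ← map_sub, subqMk_eq_zero]
    exact hxy
  · rintro ⟨x, rfl⟩
    obtain ⟨x, rfl⟩ := subqMk_surjective hN₁ hL₁ x
    change subqMap hN hL hN₂ hL₂ g.toLin hg hg'
      (subqMap hN₁ hL₁ hN hL f.toLin hf hf' _) = 0
    rw [subqMap_mk, subqMap_mk, subqMk_eq_zero]
    exact hzero x x.2

/-- The third isomorphism theorem. -/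
theorem isSES_subq_subq {U : GrMod 𝓐} {N M L : Submodule Aᵐᵒᵖ U} (hN : U.IsHomog N)
    (hM : U.IsHomog M) (hL : U.IsHomog L) (hMN : M ≤ N) (hLM : L ≤ M) :
    ∃ (a : GrHom (U.subq hM hL) (U.subq hN hL)) (b : GrHom (U.subq hN hL) (U.subq hN hM)),
      IsSES a b :=
  isSES_subq hM hL hN hL hN hM (GrHom.id U) (GrHom.id U) (fun _ h => hMN h) (fun _ h => h)
    (fun _ h => h) (fun _ h => hLM h) (fun _ _ h => h) (fun _ h => h)
    (fun y _ h => ⟨y, h, by rw [GrHom.id, LinearMap.id_apply, sub_self]; exact zero_mem _⟩)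
    (fun y h => ⟨y, h, by rw [GrHom.id, LinearMap.id_apply, sub_self]; exact zero_mem _⟩)

/-! ## Lattices -/

/-- An injective endomorphism of degree one. -/
structure Translation (U : GrMod 𝓐) where
  toLin : Module.End Aᵐᵒᵖ U
  inj : Function.Injective toLin
  map_deg : ∀ n x, x ∈ U.deg n → toLin x ∈ U.deg (n + 1)

/-- A lattice in `U` with respect to `x`: a homogeneous submodule of the form
`L + x L + x² L + ⋯` with `L` finitely generated, in which all elements of `U` come to lie after
multiplication by a power of `x`. -/
structure IsLattice {U : GrMod 𝓐} (x : Translation U) (N : Submodule Aᵐᵒᵖ U) : Prop where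
  homog : U.IsHomog N
  fg : ∃ L : Submodule Aᵐᵒᵖ U, L.FG ∧ N = ⨆ j : ℕ, L.map (x.toLin ^ j)
  absorb : ∀ u, ∃ c : ℕ, (x.toLin ^ c) u ∈ N

theorem map_pow_succ {U : GrMod 𝓐} (x : Translation U) (N : Submodule Aᵐᵒᵖ U) (j : ℕ) :
    N.map (x.toLin ^ (j + 1)) = (N.map (x.toLin ^ j)).map x.toLin := by
  rw [← Submodule.map_comp, pow_succ']
  rfl

theorem map_pow_succ' {U : GrMod 𝓐} (x : Translation U) (N : Submodule Aᵐᵒᵖ U) (j : ℕ) :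
    N.map (x.toLin ^ (j + 1)) = (N.map x.toLin).map (x.toLin ^ j) := by
  rw [← Submodule.map_comp, pow_succ]
  rfl

section

variable {U : GrMod 𝓐} {x : Translation U} {N N' : Submodule Aᵐᵒᵖ U}

theorem IsLattice.map_le (h : IsLattice x N) : N.map x.toLin ≤ N := by
  obtain ⟨L, _, rfl⟩ := h.fg
  rw [Submodule.map_iSup]
  refine iSup_le fun j => ?_
  rw [← map_pow_succ]
  exact le_iSup (fun j => L.map (x.toLin ^ j)) (j + 1)

theorem IsLattice.map_pow_le (h : IsLattice x N) (c : ℕ) : N.map (x.toLin ^ c) ≤ N := by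
  induction c with
  | zero => rw [pow_zero, Module.End.one_eq_id, Submodule.map_id]
  | succ c ih =>
    rw [map_pow_succ]
    exact (Submodule.map_mono ih).trans h.map_le

theorem IsLattice.pow_mem (h : IsLattice x N) {c d : ℕ} (hcd : c ≤ d) {u : U}
    (hu : (x.toLin ^ c) u ∈ N) : (x.toLin ^ d) u ∈ N := by
  obtain ⟨k, rfl⟩ := Nat.exists_eq_add_of_le' hcd
  rw [pow_add]
  exact h.map_pow_le k ⟨_, hu, rfl⟩

theorem le_iSup_map_pow (x : Translation U) (L : Submodule Aᵐᵒᵖ U) :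
    L ≤ ⨆ j : ℕ, L.map (x.toLin ^ j) := by
  refine le_trans (le_of_eq ?_) (le_iSup (fun j => L.map (x.toLin ^ j)) 0)
  rw [pow_zero, Module.End.one_eq_id, Submodule.map_id]

theorem iSup_map_pow_le (x : Translation U) (L : Submodule Aᵐᵒᵖ U) :
    ⨆ j : ℕ, L.map (x.toLin ^ j) ≤ L ⊔ (⨆ j : ℕ, L.map (x.toLin ^ j)).map x.toLin := by
  refine iSup_le fun j => ?_
  cases j with
  | zero =>
    rw [pow_zero, Module.End.one_eq_id, Submodule.map_id]
    exact le_sup_left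
  | succ j =>
    rw [map_pow_succ]
    exact le_trans (Submodule.map_mono (le_iSup (fun j => L.map (x.toLin ^ j)) j)) le_sup_right

/-- This makes the quotients `N / N'` with `x N ≤ N' ≤ N` finitely generated over `A`, although `N`
itself need not be. -/
theorem IsLattice.exists_generators (h : IsLattice x N) :
    ∃ L : Submodule Aᵐᵒᵖ U, L.FG ∧ L ≤ N ∧ N ≤ L ⊔ N.map x.toLin := by
  obtain ⟨L, hL, rfl⟩ := h.fg
  exact ⟨L, hL, le_iSup_map_pow x L, iSup_map_pow_le x L⟩

theorem Translation.isHomog_map (x : Translation U) (hN : U.IsHomog N) :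
    U.IsHomog (N.map x.toLin) :=
  hN.map x.toLin 1 x.map_deg

theorem IsLattice.map (h : IsLattice x N) : IsLattice x (N.map x.toLin) := by
  refine ⟨x.isHomog_map h.homog, ?_, fun u => ?_⟩
  · obtain ⟨L, hL, rfl⟩ := h.fg
    refine ⟨L.map x.toLin, hL.map _, ?_⟩
    rw [Submodule.map_iSup]
    exact iSup_congr fun j => by rw [← map_pow_succ, map_pow_succ']
  · obtain ⟨c, hc⟩ := h.absorb u
    refine ⟨c + 1, ?_⟩
    rw [pow_succ']
    exact ⟨_, hc, rfl⟩

theorem IsLattice.map_pow (h : IsLattice x N) (c : ℕ) : IsLattice x (N.map (x.toLin ^ c)) := by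
  induction c with
  | zero => rwa [pow_zero, Module.End.one_eq_id, Submodule.map_id]
  | succ c ih =>
    rw [map_pow_succ]
    exact ih.map

theorem IsLattice.sup (h : IsLattice x N) (h' : IsLattice x N') : IsLattice x (N ⊔ N') := by
  refine ⟨h.homog.sup h'.homog, ?_, fun u => ?_⟩
  · obtain ⟨L, hL, e⟩ := h.fg
    obtain ⟨L', hL', e'⟩ := h'.fg
    refine ⟨L ⊔ L', hL.sup hL', ?_⟩
    simp only [Submodule.map_sup]
    rw [iSup_sup_eq, ← e, ← e']
  · obtain ⟨c, hc⟩ := h.absorb u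
    exact ⟨c, Submodule.mem_sup_left hc⟩

/-- Each of the finitely many generators of `L` is carried into `N'` by a power of `x`. The largest
of these powers works for all of `N`, as `N'` is stable under `x`. -/
theorem IsLattice.exists_map_pow_le (h : IsLattice x N) (h' : IsLattice x N') :
    ∃ c : ℕ, N.map (x.toLin ^ c) ≤ N' := by
  obtain ⟨L, ⟨T, hT⟩, e⟩ := h.fg
  choose c hc using h'.absorb
  have hL : L.map (x.toLin ^ T.sup c) ≤ N' := by
    rw [← hT, Submodule.map_span, Submodule.span_le]
    rintro _ ⟨t, ht, rfl⟩
    exact h'.pow_mem (Finset.le_sup ht) (hc t)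
  refine ⟨T.sup c, ?_⟩
  rw [e, Submodule.map_iSup]
  refine iSup_le fun j => ?_
  rw [← Submodule.map_comp, ← Module.End.mul_eq_comp, ← pow_add, add_comm, pow_add,
    Module.End.mul_eq_comp, Submodule.map_comp]
  exact (Submodule.map_mono hL).trans (h'.map_pow_le j)

/-- The associated graded module `N / x N` of a lattice. -/
abbrev IsLattice.gr (h : IsLattice x N) : GrMod 𝓐 := U.subq h.homog (x.isHomog_map h.homog)

theorem IsLattice.finite_gr (h : IsLattice x N) : Module.Finite Aᵐᵒᵖ h.gr := by
  obtain ⟨L, hL, h1, h2⟩ := h.exists_generators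
  exact finite_subq _ _ L hL h1 h2

/-- In K̄ one has [N/xN] = [N/N'] + [N'/xN] and [N'/xN'] = [N'/xN] + [xN/xN']. Multiplication by x
is an isomorphism from N/N' to xN/xN' of degree one, hence the two classes agree modulo shifts. -/
theorem IsLattice.euler_eq_of_le (H : HasFiniteResolutions 𝓐) (h : IsLattice x N)
    (h' : IsLattice x N') (hle : N' ≤ N) (hle' : N.map x.toLin ≤ N') :
    euler h.gr = euler h'.gr := by
  have hx := x.isHomog_map h.homog
  have hx' := x.isHomog_map h'.homog
  have hxle : N'.map x.toLin ≤ N.map x.toLin := Submodule.map_mono hle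
  have fin1 : Module.Finite Aᵐᵒᵖ (U.subq h.homog h'.homog) := by
    obtain ⟨L, hL, h1, h2⟩ := h.exists_generators
    exact finite_subq _ _ L hL h1 (h2.trans (sup_le_sup_left hle' L))
  have fin2 : Module.Finite Aᵐᵒᵖ (U.subq h'.homog hx) := by
    obtain ⟨L, hL, h1, h2⟩ := h'.exists_generators
    exact finite_subq _ _ L hL h1 (h2.trans (sup_le_sup_left hxle L))
  have m : ∀ y ∈ N, x.toLin y ∈ N.map x.toLin := fun y hy => ⟨y, hy, rfl⟩
  have m' : ∀ y ∈ N', x.toLin y ∈ N'.map x.toLin := fun y hy => ⟨y, hy, rfl⟩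
  let φ := subqMap h.homog h'.homog hx hx' x.toLin m m'
  let Φ : GrHom (U.subq h.homog h'.homog) ((U.subq hx hx').shift 1) :=
    ⟨φ, fun n y hy => by
      change φ y ∈ (U.subq hx hx').deg (1 + n)
      rw [add_comm]
      exact subqMap_deg _ _ _ _ _ _ _ 1 x.map_deg n y hy⟩
  have hΦ : Function.Bijective Φ.toLin := by
    refine ⟨subqMap_injective h.homog h'.homog hx hx' x.toLin m m' ?_,
      subqMap_surjective h.homog h'.homog hx hx' x.toLin m m' ?_⟩
    · rintro y _ ⟨z, hz, e⟩
      exact x.inj e ▸ hz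
    · rintro _ ⟨y, hy, rfl⟩
      exact ⟨y, hy, by rw [sub_self]; exact zero_mem _⟩
  have fin3 : Module.Finite Aᵐᵒᵖ (U.subq hx hx') :=
    Module.Finite.of_surjective φ hΦ.2
  have e1 : euler (U.subq h.homog h'.homog) = euler (U.subq hx hx') :=
    (H.euler_congr fin1 Φ hΦ).trans (H.euler_shift fin3 1)
  obtain ⟨a, b, s⟩ := isSES_subq_subq h.homog h'.homog hx hle hle'
  obtain ⟨a', b', s'⟩ := isSES_subq_subq h'.homog hx hx' hle' hxle
  rw [IsLattice.gr, IsLattice.gr, H.euler_add s fin2 fin1, H.euler_add s' fin3 fin2, e1, add_comm]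

/-- The lattices `N + xˢ N'` descend from `N + N'` to `N` in finitely many steps, and `x (N + xˢ N')
≤ N + xˢ⁺¹ N'` makes each step an instance of `IsLattice.euler_eq_of_le`. -/
theorem IsLattice.euler_sup (H : HasFiniteResolutions 𝓐) (h : IsLattice x N)
    (h' : IsLattice x N') : euler (h.sup h').gr = euler h.gr := by
  have key : ∀ s : ℕ, euler (h.sup (h'.map_pow s)).gr = euler (h.sup h').gr := by
    intro s
    induction s with
    | zero =>
      have : N ⊔ N'.map (x.toLin ^ 0) = N ⊔ N' := by
        rw [pow_zero, Module.End.one_eq_id, Submodule.map_id]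
      congr! 2
    | succ s ih =>
      rw [← ih]
      refine ((h.sup (h'.map_pow s)).euler_eq_of_le H (h.sup (h'.map_pow (s + 1))) ?_ ?_).symm
      · refine sup_le_sup_left ?_ N
        rw [map_pow_succ]
        exact (h'.map_pow s).map_le
      · rw [Submodule.map_sup, map_pow_succ]
        exact sup_le_sup_right h.map_le _
  obtain ⟨c, hc⟩ := h'.exists_map_pow_le h
  have : N ⊔ N'.map (x.toLin ^ c) = N := sup_eq_left.2 hc
  rw [← key c]
  congr! 2

/-- The class of the associated graded module does not depend on the lattice. -/
theorem IsLattice.euler_eq (H : HasFiniteResolutions 𝓐) (h : IsLattice x N)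
    (h' : IsLattice x N') : euler h.gr = euler h'.gr := by
  rw [← h.euler_sup H h', ← h'.euler_sup H h]
  have : N ⊔ N' = N' ⊔ N := sup_comm _ _
  congr! 2

end

section Biproduct

variable {U₁ U U₂ : GrMod 𝓐} {x₁ : Translation U₁} {x : Translation U} {x₂ : Translation U₂}

/-- The graded homomorphism `f` commutes with translations. -/
def GrHom.Commutes (f : GrHom U₁ U) (x₁ : Translation U₁) (x : Translation U) : Prop :=
  ∀ u, f.toLin (x₁.toLin u) = x.toLin (f.toLin u)

theorem GrHom.Commutes.pow {f : GrHom U₁ U} (h : f.Commutes x₁ x) (j : ℕ) (u : U₁) :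
    f.toLin ((x₁.toLin ^ j) u) = (x.toLin ^ j) (f.toLin u) := by
  induction j with
  | zero => rfl
  | succ j ih =>
    rw [pow_succ', pow_succ', Module.End.mul_apply, Module.End.mul_apply, h, ih]

theorem GrHom.Commutes.map_map {f : GrHom U₁ U} (h : f.Commutes x₁ x) (j : ℕ)
    (N : Submodule Aᵐᵒᵖ U₁) :
    (N.map (x₁.toLin ^ j)).map f.toLin = (N.map f.toLin).map (x.toLin ^ j) := by
  rw [← Submodule.map_comp, ← Submodule.map_comp]
  congr 1
  exact LinearMap.ext (h.pow j)

theorem GrHom.isHomog_map (f : GrHom U₁ U) {N : Submodule Aᵐᵒᵖ U₁} (hN : U₁.IsHomog N) :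
    U.IsHomog (N.map f.toLin) :=
  hN.map f.toLin 0 fun n y hy => by rw [add_zero]; exact f.map_deg n y hy

theorem IsLattice.biproduct {i₁ : GrHom U₁ U} {i₂ : GrHom U₂ U} {p₁ : GrHom U U₁}
    {p₂ : GrHom U U₂} (c₁ : i₁.Commutes x₁ x) (c₂ : i₂.Commutes x₂ x)
    (total : ∀ u, i₁.toLin (p₁.toLin u) + i₂.toLin (p₂.toLin u) = u)
    {N₁ : Submodule Aᵐᵒᵖ U₁} {N₂ : Submodule Aᵐᵒᵖ U₂} (h₁ : IsLattice x₁ N₁)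
    (h₂ : IsLattice x₂ N₂) : IsLattice x (N₁.map i₁.toLin ⊔ N₂.map i₂.toLin) := by
  refine ⟨(i₁.isHomog_map h₁.homog).sup (i₂.isHomog_map h₂.homog), ?_, fun u => ?_⟩
  · obtain ⟨L₁, hL₁, e₁⟩ := h₁.fg
    obtain ⟨L₂, hL₂, e₂⟩ := h₂.fg
    refine ⟨L₁.map i₁.toLin ⊔ L₂.map i₂.toLin, (hL₁.map _).sup (hL₂.map _), ?_⟩
    simp only [Submodule.map_sup, ← c₁.map_map, ← c₂.map_map]
    rw [iSup_sup_eq, ← Submodule.map_iSup, ← Submodule.map_iSup, ← e₁, ← e₂]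
  · obtain ⟨a, ha⟩ := h₁.absorb (p₁.toLin u)
    obtain ⟨b, hb⟩ := h₂.absorb (p₂.toLin u)
    refine ⟨max a b, ?_⟩
    rw [← total u, map_add, ← c₁.pow, ← c₂.pow]
    exact Submodule.add_mem_sup ⟨_, h₁.pow_mem (le_max_left a b) ha, rfl⟩
      ⟨_, h₂.pow_mem (le_max_right a b) hb, rfl⟩

/-- By independence of the lattice, `N` may be replaced by `i₁ N₁ + i₂ N₂`, whose associated graded
module is an extension of that of `N₂` by that of `N₁`. -/
theorem IsLattice.euler_biproduct (H : HasFiniteResolutions 𝓐) {i₁ : GrHom U₁ U}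
    {i₂ : GrHom U₂ U} {p₁ : GrHom U U₁} {p₂ : GrHom U U₂} (c₁ : i₁.Commutes x₁ x)
    (c₂ : i₂.Commutes x₂ x) (d₁ : p₁.Commutes x x₁) (d₂ : p₂.Commutes x x₂)
    (total : ∀ u, i₁.toLin (p₁.toLin u) + i₂.toLin (p₂.toLin u) = u)
    (e₁₁ : ∀ u, p₁.toLin (i₁.toLin u) = u) (e₂₂ : ∀ u, p₂.toLin (i₂.toLin u) = u)
    (e₁₂ : ∀ u, p₁.toLin (i₂.toLin u) = 0) (e₂₁ : ∀ u, p₂.toLin (i₁.toLin u) = 0)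
    {N₁ : Submodule Aᵐᵒᵖ U₁} {N₂ : Submodule Aᵐᵒᵖ U₂} {N : Submodule Aᵐᵒᵖ U}
    (h₁ : IsLattice x₁ N₁) (h₂ : IsLattice x₂ N₂) (h : IsLattice x N) :
    euler h.gr = euler h₁.gr + euler h₂.gr := by
  have hs := IsLattice.biproduct c₁ c₂ total h₁ h₂
  rw [h.euler_eq H hs]
  have q₁ : ∀ u ∈ N₁.map i₁.toLin ⊔ N₂.map i₂.toLin, p₁.toLin u ∈ N₁ := by
    intro u hu
    obtain ⟨_, ⟨a, ha, rfl⟩, _, ⟨b, hb, rfl⟩, rfl⟩ := Submodule.mem_sup.1 hu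
    rw [map_add, e₁₁, e₁₂, add_zero]
    exact ha
  have q₂ : ∀ u ∈ N₁.map i₁.toLin ⊔ N₂.map i₂.toLin, p₂.toLin u ∈ N₂ := by
    intro u hu
    obtain ⟨_, ⟨a, ha, rfl⟩, _, ⟨b, hb, rfl⟩, rfl⟩ := Submodule.mem_sup.1 hu
    rw [map_add, e₂₁, e₂₂, zero_add]
    exact hb
  have j₁ : ∀ a ∈ N₁, i₁.toLin a ∈ N₁.map i₁.toLin ⊔ N₂.map i₂.toLin := fun a ha =>
    Submodule.mem_sup_left ⟨a, ha, rfl⟩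
  have j₂ : ∀ b ∈ N₂, i₂.toLin b ∈ N₁.map i₁.toLin ⊔ N₂.map i₂.toLin := fun b hb =>
    Submodule.mem_sup_right ⟨b, hb, rfl⟩
  obtain ⟨a, b, hab⟩ := isSES_subq h₁.homog (x₁.isHomog_map h₁.homog) hs.homog
    (x.isHomog_map hs.homog) h₂.homog (x₂.isHomog_map h₂.homog) i₁ p₂ j₁
    (by
      rintro _ ⟨a, ha, rfl⟩
      exact ⟨_, j₁ a ha, (c₁ a).symm⟩) q₂
    (by
      rintro _ ⟨u, hu, rfl⟩
      exact ⟨_, q₂ u hu, (d₂ u).symm⟩)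
    (by
      rintro a _ ⟨u, hu, e⟩
      refine ⟨_, q₁ u hu, ?_⟩
      rw [← d₁, e, e₁₁])
    (fun a _ => by rw [e₂₁]; exact zero_mem _)
    (by
      rintro u hu ⟨b, hb, e⟩
      refine ⟨_, q₁ u hu, ?_⟩
      have : u - i₁.toLin (p₁.toLin u) = i₂.toLin (p₂.toLin u) := by
        rw [sub_eq_iff_eq_add']
        exact (total u).symm
      rw [this, ← e, c₂]
      exact ⟨_, j₂ b hb, rfl⟩)
    (fun b hb => ⟨_, j₂ b hb, by rw [e₂₂, sub_self]; exact zero_mem _⟩)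
  exact H.euler_add hab h₁.finite_gr h₂.finite_gr

end Biproduct

end Lattice

/-! ### The twisted Laurent module P[x, x⁻¹] and its lattices -/

section Laurent

variable {A : Type u} [Ring A]

/-! ## Laurent polynomials over a module -/

/-- The Laurent polynomials `P[x, x⁻¹]` over a right module `P`, with the module structure
`(p xⁿ) a = (p a) xⁿ⁺ᵈ` for `a` homogeneous of degree `d`. -/
def Laurent (_𝓐 : ℤ → AddSubgroup A) (P : Type u) [AddCommGroup P] : Type u := ℤ →₀ P

/-- Only the additive structure is taken from `ℤ →₀ P`: its coefficientwise action of `Aᵐᵒᵖ` ignores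
the degrees of scalars and is not the one wanted. -/
noncomputable instance (𝓐 : ℤ → AddSubgroup A) (P : Type u) [AddCommGroup P] :
    AddCommGroup (Laurent 𝓐 P) :=
  inferInstanceAs (AddCommGroup (ℤ →₀ P))

variable {𝓐 : ℤ → AddSubgroup A} {P Q : Type u} [AddCommGroup P] [AddCommGroup Q]

namespace Laurent

variable (𝓐) in
/-- The monomial `p xⁿ`. -/
noncomputable def mono (n : ℤ) : P →+ Laurent 𝓐 P := Finsupp.singleAddHom n

/-- The coefficient of `xⁿ`. -/
noncomputable def coeff (n : ℤ) : Laurent 𝓐 P →+ P := Finsupp.applyAddHom n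

theorem coeff_mono_same (n : ℤ) (p : P) : coeff n (mono 𝓐 n p) = p := Finsupp.single_eq_same

theorem coeff_mono_ne {n m : ℤ} (h : n ≠ m) (p : P) : coeff n (mono 𝓐 m p) = 0 :=
  Finsupp.single_eq_of_ne h

theorem induction {C : Laurent 𝓐 P → Prop} (f : Laurent 𝓐 P) (mono : ∀ n p, C (mono 𝓐 n p))
    (add : ∀ f g, C f → C g → C (f + g)) : C f :=
  Finsupp.induction_linear f (map_zero (Laurent.mono 𝓐 (0 : ℤ) : P →+ _) ▸ mono 0 0) (fun f g => add f g) mono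

theorem addHom_ext {B : Type*} [AddMonoid B] {φ ψ : Laurent 𝓐 P →+ B}
    (h : ∀ n p, φ (mono 𝓐 n p) = ψ (mono 𝓐 n p)) : φ = ψ :=
  Finsupp.addHom_ext h

/-- Additive maps on Laurent polynomials are given by their values on monomials. -/
noncomputable def lift {B : Type*} [AddCommMonoid B] (φ : ℤ → P →+ B) : Laurent 𝓐 P →+ B :=
  Finsupp.liftAddHom φ

theorem lift_mono {B : Type*} [AddCommMonoid B] (φ : ℤ → P →+ B) (n : ℤ) (p : P) :
    lift φ (mono 𝓐 n p) = φ n p :=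
  Finsupp.liftAddHom_apply_single φ n p

/-- The action of an element of `𝓐 d`. -/
noncomputable def homogAct (𝓐 : ℤ → AddSubgroup A) (P : Type u) [AddCommGroup P] [Module Aᵐᵒᵖ P]
    (d : ℤ) : 𝓐 d →+ Laurent 𝓐 P →+ Laurent 𝓐 P :=
  AddMonoidHom.mk' (fun a => lift fun n => (mono 𝓐 (n + d)).comp
    (DistribSMul.toAddMonoidHom P (MulOpposite.op (a : A)))) fun a b => by
      refine addHom_ext fun n p => ?_
      rw [AddMonoidHom.add_apply, lift_mono, lift_mono, lift_mono]
      change mono 𝓐 (n + d) (MulOpposite.op ((a : A) + (b : A)) • p) =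
        mono 𝓐 (n + d) (MulOpposite.op (a : A) • p) + mono 𝓐 (n + d) (MulOpposite.op (b : A) • p)
      rw [MulOpposite.op_add, add_smul, map_add]

variable [Module Aᵐᵒᵖ P] [Module Aᵐᵒᵖ Q] [GradedRing 𝓐]

/-- The right action of `A`. -/
noncomputable def act (𝓐 : ℤ → AddSubgroup A) [GradedRing 𝓐] (P : Type u) [AddCommGroup P]
    [Module Aᵐᵒᵖ P] : A →+ Laurent 𝓐 P →+ Laurent 𝓐 P :=
  (DirectSum.toAddMonoid (homogAct 𝓐 P)).comp (DirectSum.decomposeAddEquiv 𝓐).toAddMonoidHom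

theorem act_mono {a : A} {d : ℤ} (ha : a ∈ 𝓐 d) (n : ℤ) (p : P) :
    act 𝓐 P a (mono 𝓐 n p) = mono 𝓐 (n + d) (MulOpposite.op a • p) := by
  have : DirectSum.decompose 𝓐 a = DirectSum.of (fun i => 𝓐 i) d ⟨a, ha⟩ :=
    DirectSum.decompose_of_mem 𝓐 ha
  change DirectSum.toAddMonoid (homogAct 𝓐 P) (DirectSum.decompose 𝓐 a) _ = _
  rw [this, DirectSum.toAddMonoid_of]
  exact lift_mono _ n p

theorem act_mul (a b : A) (f : Laurent 𝓐 P) :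
    act 𝓐 P (a * b) f = act 𝓐 P b (act 𝓐 P a f) := by
  induction a using DirectSum.Decomposition.inductionOn 𝓐 with
  | zero => rw [zero_mul, map_zero, AddMonoidHom.zero_apply, map_zero]
  | add a a' h h' =>
    rw [add_mul, map_add, map_add, AddMonoidHom.add_apply, AddMonoidHom.add_apply, map_add, h, h']
  | @homogeneous i a =>
    induction b using DirectSum.Decomposition.inductionOn 𝓐 with
    | zero => rw [mul_zero, map_zero, AddMonoidHom.zero_apply]; rfl
    | add b b' h h' =>
      rw [mul_add, map_add, map_add, AddMonoidHom.add_apply, AddMonoidHom.add_apply, h, h']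
    | @homogeneous j b =>
      induction f using Laurent.induction with
      | add f g hf hg => simp only [map_add, hf, hg]
      | mono n p =>
        rw [act_mono (SetLike.mul_mem_graded a.2 b.2), act_mono a.2, act_mono b.2, add_assoc,
          MulOpposite.op_mul, mul_smul]

theorem act_one (f : Laurent 𝓐 P) : act 𝓐 P 1 f = f := by
  induction f using Laurent.induction with
  | add f g hf hg => rw [map_add, hf, hg]
  | mono n p =>
    rw [act_mono (SetLike.one_mem_graded 𝓐), add_zero, MulOpposite.op_one, one_smul]

noncomputable instance : Module Aᵐᵒᵖ (Laurent 𝓐 P) where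
  smul a f := act 𝓐 P a.unop f
  one_smul f := act_one f
  mul_smul a b f := act_mul b.unop a.unop f
  smul_zero a := map_zero (act 𝓐 P a.unop)
  smul_add a f g := map_add (act 𝓐 P a.unop) f g
  add_smul a b f := by
    change act 𝓐 P (a.unop + b.unop) f = _
    rw [map_add]
    rfl
  zero_smul f := by
    change act 𝓐 P 0 f = 0
    rw [map_zero]
    rfl

theorem smul_mono {a : A} {d : ℤ} (ha : a ∈ 𝓐 d) (n : ℤ) (p : P) :
    MulOpposite.op a • mono 𝓐 n p = mono 𝓐 (n + d) (MulOpposite.op a • p) :=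
  act_mono ha n p

/-- An additive map that is linear with respect to homogeneous elements is linear. -/
def toLin {M N : Type*} [AddCommGroup M] [AddCommGroup N] [Module Aᵐᵒᵖ M] [Module Aᵐᵒᵖ N]
    (𝓐 : ℤ → AddSubgroup A) [GradedRing 𝓐] (φ : M →+ N)
    (h : ∀ d, ∀ a ∈ 𝓐 d, ∀ m, φ (MulOpposite.op a • m) = MulOpposite.op a • φ m) :
    M →ₗ[Aᵐᵒᵖ] N :=
  { φ with
    map_smul' := fun a m => by
      obtain ⟨a, rfl⟩ := MulOpposite.op_surjective a
      change φ (MulOpposite.op a • m) = MulOpposite.op a • φ m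
      induction a using DirectSum.Decomposition.inductionOn 𝓐 with
      | zero => rw [MulOpposite.op_zero, zero_smul, zero_smul, map_zero]
      | homogeneous a => exact h _ _ a.2 m
      | add a b ha hb => rw [MulOpposite.op_add, add_smul, add_smul, map_add, ha, hb] }

/-- Additive maps on Laurent polynomials that are linear on monomials. -/
noncomputable def liftLin {N : Type*} [AddCommGroup N] [Module Aᵐᵒᵖ N] (φ : ℤ → P →+ N)
    (h : ∀ d, ∀ a ∈ 𝓐 d, ∀ n p, φ (n + d) (MulOpposite.op a • p) = MulOpposite.op a • φ n p) :
    Laurent 𝓐 P →ₗ[Aᵐᵒᵖ] N :=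
  toLin 𝓐 (lift φ) fun d a ha f => by
    induction f using Laurent.induction with
    | add f g hf hg => rw [smul_add, map_add, map_add, smul_add, hf, hg]
    | mono n p => rw [smul_mono ha, lift_mono, lift_mono, h d a ha]

theorem liftLin_mono {N : Type*} [AddCommGroup N] [Module Aᵐᵒᵖ N] (φ : ℤ → P →+ N)
    (h : ∀ d, ∀ a ∈ 𝓐 d, ∀ n p, φ (n + d) (MulOpposite.op a • p) = MulOpposite.op a • φ n p)
    (n : ℤ) (p : P) : liftLin φ h (mono 𝓐 n p) = φ n p :=
  lift_mono φ n p

end Laurent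

variable [Module Aᵐᵒᵖ P] [Module Aᵐᵒᵖ Q] [GradedRing 𝓐]

variable (𝓐 P) in
/-- The graded module of Laurent polynomials. -/
noncomputable abbrev laurent : GrMod 𝓐 where
  carrier := Laurent 𝓐 P
  deg n := (Laurent.mono 𝓐 n).range
  isInternal := by
    refine isInternal_of_proj _ (fun i => (Laurent.mono 𝓐 i).comp (Laurent.coeff i)) ?_ ?_ ?_
    · rintro i _ ⟨p, rfl⟩
      exact congrArg (Laurent.mono 𝓐 i) (Laurent.coeff_mono_same i p)
    · rintro i j h _ ⟨p, rfl⟩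
      exact (congrArg (Laurent.mono 𝓐 i) (Laurent.coeff_mono_ne h p)).trans (map_zero _)
    · intro f
      induction f using Laurent.induction with
      | mono n p => exact AddSubgroup.mem_iSup_of_mem n ⟨p, rfl⟩
      | add f g hf hg => exact add_mem hf hg
  smul_mem := by
    rintro i j _ a ⟨p, rfl⟩ ha
    exact ⟨_, (Laurent.smul_mono ha i p).symm⟩

namespace Laurent

/-- Multiplication by `xᵏ`. -/
noncomputable def shiftBy (k : ℤ) : Laurent 𝓐 P →ₗ[Aᵐᵒᵖ] Laurent 𝓐 P :=
  liftLin (fun n => mono 𝓐 (n + k)) fun d a ha n p => by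
    rw [smul_mono ha, add_right_comm]

theorem shiftBy_mono (k n : ℤ) (p : P) : shiftBy k (mono 𝓐 n p) = mono 𝓐 (n + k) p :=
  liftLin_mono _ _ n p

theorem shiftBy_shiftBy (k l : ℤ) (f : Laurent 𝓐 P) :
    shiftBy k (shiftBy l f) = shiftBy (l + k) f := by
  induction f using Laurent.induction with
  | mono n p => rw [shiftBy_mono, shiftBy_mono, shiftBy_mono, add_assoc]
  | add f g hf hg => simp only [map_add, hf, hg]

theorem shiftBy_zero (f : Laurent 𝓐 P) : shiftBy 0 f = f := by
  induction f using Laurent.induction with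
  | mono n p => rw [shiftBy_mono, add_zero]
  | add f g hf hg => rw [map_add, hf, hg]

theorem shiftBy_injective (k : ℤ) : Function.Injective (shiftBy k : Laurent 𝓐 P →ₗ[Aᵐᵒᵖ] _) :=
  Function.LeftInverse.injective (g := shiftBy (-k)) fun f => by
    rw [shiftBy_shiftBy, add_neg_cancel, shiftBy_zero]

theorem shiftBy_deg (k : ℤ) (n : ℤ) (f : Laurent 𝓐 P) (hf : f ∈ (laurent 𝓐 P).deg n) :
    (shiftBy k f : Laurent 𝓐 P) ∈ (laurent 𝓐 P).deg (n + k) := by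
  obtain ⟨p, rfl⟩ := hf
  exact ⟨p, (shiftBy_mono k n p).symm⟩

theorem coeff_shiftBy (k n : ℤ) (f : Laurent 𝓐 P) : coeff n (shiftBy k f) = coeff (n - k) f := by
  induction f using Laurent.induction with
  | add f g hf hg => simp only [map_add, hf, hg]
  | mono m p =>
    rw [shiftBy_mono]
    by_cases h : n = m + k
    · subst h
      rw [coeff_mono_same, add_sub_cancel_right, coeff_mono_same]
    · rw [coeff_mono_ne h, coeff_mono_ne (by omega)]

variable (𝓐 P) in
/-- Multiplication by `x`. -/
noncomputable def x : Translation (laurent 𝓐 P) := ⟨shiftBy 1, shiftBy_injective 1, shiftBy_deg 1⟩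

theorem x_pow (j : ℕ) (f : Laurent 𝓐 P) : ((x 𝓐 P).toLin ^ j) f = shiftBy (j : ℤ) f := by
  induction j with
  | zero => exact (shiftBy_zero f).symm
  | succ j ih =>
    rw [pow_succ', Module.End.mul_apply, ih]
    exact (shiftBy_shiftBy 1 j f).trans (by push_cast; rfl)

variable (𝓐) in
/-- The linear map of Laurent polynomials induced by a linear map. -/
noncomputable def mapLin (φ : P →ₗ[Aᵐᵒᵖ] Q) : Laurent 𝓐 P →ₗ[Aᵐᵒᵖ] Laurent 𝓐 Q :=
  liftLin (fun n => (mono 𝓐 n).comp φ.toAddMonoidHom) fun d a ha n p => by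
    change mono 𝓐 (n + d) (φ (MulOpposite.op a • p)) = MulOpposite.op a • mono 𝓐 n (φ p)
    rw [smul_mono ha, map_smul]

theorem mapLin_mono (φ : P →ₗ[Aᵐᵒᵖ] Q) (n : ℤ) (p : P) :
    mapLin 𝓐 φ (mono 𝓐 n p) = mono 𝓐 n (φ p) :=
  lift_mono (fun n => (mono 𝓐 n).comp φ.toAddMonoidHom) n p

variable (𝓐) in
/-- The graded homomorphism of Laurent polynomials induced by a linear map. -/
noncomputable def map (φ : P →ₗ[Aᵐᵒᵖ] Q) : GrHom (laurent 𝓐 P) (laurent 𝓐 Q) :=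
  ⟨mapLin 𝓐 φ, by
    rintro n _ ⟨p, rfl⟩
    exact ⟨φ p, (mapLin_mono φ n p).symm⟩⟩

theorem map_mono (φ : P →ₗ[Aᵐᵒᵖ] Q) (n : ℤ) (p : P) :
    (map 𝓐 φ).toLin (mono 𝓐 n p) = mono 𝓐 n (φ p) :=
  mapLin_mono φ n p

theorem map_commutes (φ : P →ₗ[Aᵐᵒᵖ] Q) : (map 𝓐 φ).Commutes (x 𝓐 P) (x 𝓐 Q) := by
  intro (f : Laurent 𝓐 P)
  change (map 𝓐 φ).toLin (shiftBy 1 f) = shiftBy 1 ((map 𝓐 φ).toLin f)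
  induction f using Laurent.induction with
  | mono n p => rw [shiftBy_mono, map_mono, map_mono, shiftBy_mono]
  | add f g hf hg => simp only [map_add, hf, hg]

theorem map_map {R : Type u} [AddCommGroup R] [Module Aᵐᵒᵖ R] (φ : P →ₗ[Aᵐᵒᵖ] Q)
    (ψ : Q →ₗ[Aᵐᵒᵖ] R) (f : Laurent 𝓐 P) :
    (map 𝓐 ψ).toLin ((map 𝓐 φ).toLin f) = (map 𝓐 (ψ.comp φ)).toLin f := by
  induction f using Laurent.induction with
  | mono n p => rw [map_mono, map_mono, map_mono]; rfl
  | add f g hf hg => simp only [map_add, hf, hg]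

theorem map_id (f : Laurent 𝓐 P) : (map 𝓐 (LinearMap.id : P →ₗ[Aᵐᵒᵖ] P)).toLin f = f := by
  induction f using Laurent.induction with
  | mono n p => rw [map_mono]; rfl
  | add f g hf hg => rw [map_add, hf, hg]

theorem map_zero_apply (f : Laurent 𝓐 P) : (map 𝓐 (0 : P →ₗ[Aᵐᵒᵖ] Q)).toLin f = 0 := by
  induction f using Laurent.induction with
  | mono n p => rw [map_mono, LinearMap.zero_apply, map_zero]
  | add f g hf hg => rw [map_add, hf, hg, add_zero]

theorem map_add_apply (φ ψ : P →ₗ[Aᵐᵒᵖ] Q) (f : Laurent 𝓐 P) :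
    (map 𝓐 (φ + ψ)).toLin f = (map 𝓐 φ).toLin f + (map 𝓐 ψ).toLin f := by
  induction f using Laurent.induction with
  | mono n p => rw [map_mono, map_mono, map_mono, LinearMap.add_apply, map_add]
  | add f g hf hg => simp only [map_add, hf, hg]; abel

/-- The evaluation at `x = 1`. -/
noncomputable def eval (𝓐 : ℤ → AddSubgroup A) [GradedRing 𝓐] (P : Type u) [AddCommGroup P]
    [Module Aᵐᵒᵖ P] : Laurent 𝓐 P →ₗ[Aᵐᵒᵖ] P :=
  liftLin (fun _ => AddMonoidHom.id P) fun _ _ _ _ _ => rfl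

theorem eval_mono (n : ℤ) (p : P) : eval 𝓐 P (mono 𝓐 n p) = p := liftLin_mono _ _ n p

theorem eval_shiftBy (k : ℤ) (f : Laurent 𝓐 P) : eval 𝓐 P (shiftBy k f) = eval 𝓐 P f := by
  induction f using Laurent.induction with
  | mono n p => rw [shiftBy_mono, eval_mono, eval_mono]
  | add f g hf hg => simp only [map_add, hf, hg]

/-- The multiples of `1 - x` among Laurent polynomials. -/
noncomputable def oneSub (𝓐 : ℤ → AddSubgroup A) [GradedRing 𝓐] (P : Type u) [AddCommGroup P]
    [Module Aᵐᵒᵖ P] : Laurent 𝓐 P →ₗ[Aᵐᵒᵖ] Laurent 𝓐 P :=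
  LinearMap.id - shiftBy 1

theorem oneSub_apply (f : Laurent 𝓐 P) : oneSub 𝓐 P f = f - shiftBy 1 f := rfl

/-- If `f = x f`, all coefficients of `f` are equal, and only finitely many are nonzero. -/
theorem oneSub_injective : Function.Injective (oneSub 𝓐 P) := by
  rw [injective_iff_map_eq_zero]
  intro f hf
  rw [oneSub_apply, sub_eq_zero] at hf
  have h1 : ∀ n, coeff n f = coeff (n - 1) f := fun n => by
    conv_lhs => rw [hf, coeff_shiftBy]
  have hstep : ∀ (n : ℤ) (k : ℕ), coeff n f = coeff (n + k) f := by
    intro n k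
    induction k with
    | zero => rw [Nat.cast_zero, add_zero]
    | succ k ih => rw [ih, h1 (n + (k + 1 : ℕ))]; congr 2; push_cast; ring
  suffices h0 : ∀ n, coeff n f = 0 from Finsupp.ext h0
  intro n
  by_contra hn
  have hsub : Set.range (fun k : ℕ => n + (k : ℤ)) ⊆ (↑(Finsupp.support (M := P) f) : Set ℤ) := by
    rintro _ ⟨k, rfl⟩
    exact Finsupp.mem_support_iff.2 fun h0 => hn ((hstep n k).trans h0)
  refine Set.infinite_range_of_injective ?_ ((Finset.finite_toSet _).subset hsub)
  intro a b hab
  simpa using hab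

/-- The difference `xᵏ - 1` telescopes into multiples of `1 - x`, for negative `k` as well. -/
theorem shiftBy_sub_mem_range (k : ℤ) (f : Laurent 𝓐 P) :
    shiftBy k f - f ∈ LinearMap.range (oneSub 𝓐 P) := by
  have step : ∀ (k : ℤ), shiftBy (k + 1) f - shiftBy k f ∈ LinearMap.range (oneSub 𝓐 P) := by
    intro k
    refine ⟨-shiftBy k f, ?_⟩
    rw [oneSub_apply, map_neg, shiftBy_shiftBy]
    abel
  induction k using Int.induction_on with
  | zero => rw [shiftBy_zero, sub_self]; exact zero_mem _
  | succ n ih => simpa using add_mem (step n) ih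
  | pred n ih =>
    have := sub_mem ih (step (-n - 1))
    rw [sub_add_cancel] at this
    simpa using this

/-- Modulo multiples of `1 - x`, every `f` is congruent to the constant `eval f`. -/
theorem exact_oneSub_eval : Function.Exact (oneSub 𝓐 P) (eval 𝓐 P) := by
  intro f
  constructor
  · intro hf
    have key : ∀ f : Laurent 𝓐 P,
        f - mono 𝓐 0 (eval 𝓐 P f) ∈ LinearMap.range (oneSub 𝓐 P) := by
      intro f
      induction f using Laurent.induction with
      | mono n p =>
        have := shiftBy_sub_mem_range n (mono 𝓐 0 p)
        rw [shiftBy_mono, zero_add] at this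
        rwa [eval_mono]
      | add f g hf hg =>
        have e : f + g - mono 𝓐 0 (eval 𝓐 P (f + g)) =
            (f - mono 𝓐 0 (eval 𝓐 P f)) + (g - mono 𝓐 0 (eval 𝓐 P g)) := by
          rw [map_add, map_add]
          abel
        rw [e]
        exact add_mem hf hg
    have := key f
    rwa [hf, map_zero, sub_zero] at this
  · rintro ⟨g, rfl⟩
    rw [oneSub_apply, map_sub, eval_shiftBy, sub_self]

/-! ## The class of a finitely generated module -/

/-- For `a` of degree `i`, the monomial `(p a) xⁿ⁺ᵈ` is `(p xⁿ⁻ⁱ⁺ᵈ) a`. Scalars thus move the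
exponent, so `n` must be arbitrary; sums require membership for all large `d` rather than for one.
-/
theorem shiftBy_mem_of_span (N : Submodule Aᵐᵒᵖ (Laurent 𝓐 P)) {S : Set P}
    (hS : Submodule.span Aᵐᵒᵖ S = ⊤)
    (h : ∀ s ∈ S, ∀ n : ℤ, ∃ c : ℕ, ∀ d : ℕ, c ≤ d → mono 𝓐 (n + d) s ∈ N) (p : P) (n : ℤ) :
    ∃ c : ℕ, ∀ d : ℕ, c ≤ d → mono 𝓐 (n + d) p ∈ N := by
  have hp : p ∈ Submodule.span Aᵐᵒᵖ S := hS ▸ trivial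
  induction hp using Submodule.span_induction generalizing n with
  | mem s hs => exact h s hs n
  | zero => exact ⟨0, fun d _ => by rw [map_zero]; exact zero_mem _⟩
  | add p q _ _ hp hq =>
    obtain ⟨c, hc⟩ := hp n
    obtain ⟨c', hc'⟩ := hq n
    refine ⟨max c c', fun d hd => ?_⟩
    rw [map_add]
    exact add_mem (hc d (le_trans (le_max_left _ _) hd)) (hc' d (le_trans (le_max_right _ _) hd))
  | smul a p _ hp =>
    obtain ⟨a, rfl⟩ := MulOpposite.op_surjective a
    induction a using DirectSum.Decomposition.inductionOn 𝓐 with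
    | zero =>
      refine ⟨0, fun d _ => ?_⟩
      rw [MulOpposite.op_zero, zero_smul, map_zero]
      exact zero_mem _
    | @homogeneous i a =>
      obtain ⟨c, hc⟩ := hp (n - i)
      refine ⟨c, fun d hd => ?_⟩
      have := smul_mono a.2 (n - i + d) p
      rw [show n - i + d + i = n + d by ring] at this
      rw [← this]
      exact N.smul_mem _ (hc d hd)
    | add a b ha hb =>
      obtain ⟨c, hc⟩ := ha
      obtain ⟨c', hc'⟩ := hb
      refine ⟨max c c', fun d hd => ?_⟩
      rw [MulOpposite.op_add, add_smul, map_add]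
      exact add_mem (hc d (le_trans (le_max_left _ _) hd)) (hc' d (le_trans (le_max_right _ _) hd))

/-- A submodule of the form `L + x L + x² L + ⋯` that contains high powers of `x` times the
elements of a generating set is a lattice. -/
theorem isLattice (L : Submodule Aᵐᵒᵖ (Laurent 𝓐 P)) (hL : L.FG)
    (hom : (laurent 𝓐 P).IsHomog L) {S : Set P} (hS : Submodule.span Aᵐᵒᵖ S = ⊤)
    (h : ∀ s ∈ S, ∃ n, mono 𝓐 n s ∈ L) :
    IsLattice (x 𝓐 P) (⨆ j : ℕ, L.map ((x 𝓐 P).toLin ^ j)) := by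
  have hmem : ∀ f ∈ L, ∀ j : ℕ, shiftBy (j : ℤ) f ∈ ⨆ j : ℕ, L.map ((x 𝓐 P).toLin ^ j) :=
    fun f hf j => Submodule.mem_iSup_of_mem j ⟨f, hf, x_pow j f⟩
  have habs := shiftBy_mem_of_span (⨆ j : ℕ, L.map ((x 𝓐 P).toLin ^ j)) hS fun s hs n => by
    obtain ⟨m, hm⟩ := h s hs
    -- From `d ≥ m - n` on, `s xⁿ⁺ᵈ` is `s xᵐ` times a nonnegative power of `x`.
    refine ⟨(m - n).toNat, fun d hd => ?_⟩
    have := hmem _ hm (n + d - m).toNat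
    rw [shiftBy_mono] at this
    rwa [show m + ((n + d - m).toNat : ℤ) = n + d by omega] at this
  refine ⟨GrMod.IsHomog.iSup fun j => hom.map _ j fun n f hf => ?_, ⟨L, hL, rfl⟩,
    fun (f : Laurent 𝓐 P) => ?_⟩
  · change ((x 𝓐 P).toLin ^ j) f ∈ _
    rw [x_pow]
    exact shiftBy_deg j n f hf
  · suffices ∃ c : ℕ, ∀ d : ℕ, c ≤ d → shiftBy (d : ℤ) f ∈ ⨆ j : ℕ, L.map ((x 𝓐 P).toLin ^ j) by
      obtain ⟨c, hc⟩ := this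
      refine ⟨c, ?_⟩
      rw [x_pow]
      exact hc c le_rfl
    induction f using Laurent.induction with
    | mono n p =>
      obtain ⟨c, hc⟩ := habs p n
      refine ⟨c, fun d hd => ?_⟩
      rw [shiftBy_mono]
      exact hc d hd
    | add f g hf hg =>
      obtain ⟨c, hc⟩ := hf
      obtain ⟨c', hc'⟩ := hg
      refine ⟨max c c', fun d hd => ?_⟩
      rw [map_add]
      exact add_mem (hc d (le_trans (le_max_left _ _) hd)) (hc' d (le_trans (le_max_right _ _) hd))

theorem isHomog_span_mono (S : Set P) (n : ℤ) :
    (laurent 𝓐 P).IsHomog (Submodule.span Aᵐᵒᵖ (mono 𝓐 n '' S)) :=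
  GrMod.isHomog_span (by
    rintro _ ⟨s, _, rfl⟩
    exact ⟨n, s, rfl⟩)

theorem exists_isLattice (hP : Module.Finite Aᵐᵒᵖ P) : ∃ N, IsLattice (x 𝓐 P) N := by
  obtain ⟨S, hS⟩ := hP.1
  exact ⟨_, isLattice (Submodule.span Aᵐᵒᵖ (mono 𝓐 0 '' (S : Set P)))
    (Submodule.fg_span (S.finite_toSet.image _)) (isHomog_span_mono _ 0) hS
    fun s hs => ⟨0, Submodule.subset_span ⟨s, hs, rfl⟩⟩⟩

end Laurent

end Laurent

/-! ### The left inverse K₀(A) → K̄ and injectivity -/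

section Class

variable {A : Type u} [Ring A] {𝓐 : ℤ → AddSubgroup A} [GradedRing 𝓐]

/-! ## The map from `K₀(A)` -/

variable (𝓐) in
/-- The class of the associated graded module of a lattice in `P[x, x⁻¹]`. -/
noncomputable def FGProj.grClass (P : FGProj A) : KBar 𝓐 :=
  euler (Laurent.exists_isLattice (𝓐 := 𝓐) P.finite).choose_spec.gr

/-- This frees `grClass` from its chosen lattice. -/
theorem IsLattice.euler_gr (H : HasFiniteResolutions 𝓐) (P : FGProj A)
    {N : Submodule Aᵐᵒᵖ (laurent 𝓐 P)} (h : IsLattice (Laurent.x 𝓐 P) N) :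
    euler h.gr = P.grClass 𝓐 :=
  h.euler_eq H _

/-- The abstract form of a biproduct yields additivity, the value at zero (from 0 = 0 ⊕ 0) and
invariance under isomorphism (from Q = P ⊕ 0) all at once. -/
theorem FGProj.grClass_biproduct (H : HasFiniteResolutions 𝓐) {P P₁ P₂ : FGProj A}
    (i₁ : P₁ →ₗ[Aᵐᵒᵖ] P) (i₂ : P₂ →ₗ[Aᵐᵒᵖ] P) (p₁ : P →ₗ[Aᵐᵒᵖ] P₁) (p₂ : P →ₗ[Aᵐᵒᵖ] P₂)
    (total : i₁.comp p₁ + i₂.comp p₂ = LinearMap.id) (e₁₁ : p₁.comp i₁ = LinearMap.id)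
    (e₂₂ : p₂.comp i₂ = LinearMap.id) (e₁₂ : p₁.comp i₂ = 0) (e₂₁ : p₂.comp i₁ = 0) :
    P.grClass 𝓐 = P₁.grClass 𝓐 + P₂.grClass 𝓐 := by
  obtain ⟨N, h⟩ := Laurent.exists_isLattice (𝓐 := 𝓐) P.finite
  obtain ⟨N₁, h₁⟩ := Laurent.exists_isLattice (𝓐 := 𝓐) P₁.finite
  obtain ⟨N₂, h₂⟩ := Laurent.exists_isLattice (𝓐 := 𝓐) P₂.finite
  rw [← h.euler_gr H, ← h₁.euler_gr H, ← h₂.euler_gr H]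
  refine IsLattice.euler_biproduct H (Laurent.map_commutes i₁) (Laurent.map_commutes i₂)
    (Laurent.map_commutes p₁) (Laurent.map_commutes p₂) (fun u => ?_) (fun u => ?_) (fun u => ?_)
    (fun u => ?_) (fun u => ?_) h₁ h₂ h
  · rw [Laurent.map_map, Laurent.map_map, ← Laurent.map_add_apply, total, Laurent.map_id]
  · rw [Laurent.map_map, e₁₁, Laurent.map_id]
  · rw [Laurent.map_map, e₂₂, Laurent.map_id]
  · rw [Laurent.map_map, e₁₂, Laurent.map_zero_apply]
  · rw [Laurent.map_map, e₂₁, Laurent.map_zero_apply]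

theorem FGProj.grClass_prod (H : HasFiniteResolutions 𝓐) (P Q : FGProj A) :
    (P.prod Q).grClass 𝓐 = P.grClass 𝓐 + Q.grClass 𝓐 :=
  grClass_biproduct (P := P.prod Q) H (LinearMap.inl Aᵐᵒᵖ P Q) (LinearMap.inr Aᵐᵒᵖ P Q)
    (LinearMap.fst Aᵐᵒᵖ P Q) (LinearMap.snd Aᵐᵒᵖ P Q)
    (LinearMap.ext fun z => Prod.ext (add_zero z.1) (zero_add z.2)) rfl rfl rfl rfl

theorem FGProj.grClass_zero (H : HasFiniteResolutions 𝓐) : (FGProj.zero A).grClass 𝓐 = 0 := by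
  have := grClass_biproduct (𝓐 := 𝓐) (P := FGProj.zero A) (P₁ := FGProj.zero A)
    (P₂ := FGProj.zero A) H 0 0 0 0 rfl rfl rfl rfl rfl
  simpa using this

theorem FGProj.grClass_congr (H : HasFiniteResolutions 𝓐) {P Q : FGProj A}
    (e : P ≃ₗ[Aᵐᵒᵖ] Q) : P.grClass 𝓐 = Q.grClass 𝓐 := by
  have := grClass_biproduct (𝓐 := 𝓐) (P := Q) (P₁ := P) (P₂ := FGProj.zero A) H e.toLinearMap 0
    e.symm.toLinearMap 0 (by ext; simp) (by ext; simp) rfl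
    (LinearMap.comp_zero _) (LinearMap.zero_comp _)
  rw [this, grClass_zero H, add_zero]

/-- The homomorphism from `V A` given by associated graded modules of lattices. -/
noncomputable def grHom (H : HasFiniteResolutions 𝓐) : V A →+ KBar 𝓐 where
  toFun := Quotient.lift (fun P => P.grClass 𝓐) fun _ _ ⟨e⟩ => FGProj.grClass_congr H e
  map_zero' := FGProj.grClass_zero H
  map_add' := by
    rintro ⟨P⟩ ⟨Q⟩
    exact FGProj.grClass_prod H P Q

/-! ## The standard lattice of a graded module -/

/-- The additive map `q ↦ ∑ qₙ xⁿ`. -/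
noncomputable def GrMod.homogenizeAdd (Q : GrMod 𝓐) : Q →+ Laurent 𝓐 Q :=
  letI := Q.isInternal.chooseDecomposition
  (DirectSum.toAddMonoid fun n => (Laurent.mono 𝓐 n).comp (Q.deg n).subtype).comp
    (DirectSum.decomposeAddEquiv Q.deg).toAddMonoidHom

theorem GrMod.homogenizeAdd_apply (Q : GrMod 𝓐) {n : ℤ} {q : Q} (hq : q ∈ Q.deg n) :
    Q.homogenizeAdd q = Laurent.mono 𝓐 n q := by
  let _ := Q.isInternal.chooseDecomposition
  have : DirectSum.decompose Q.deg q = DirectSum.of (fun i => Q.deg i) n ⟨q, hq⟩ :=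
    DirectSum.decompose_of_mem Q.deg hq
  change DirectSum.toAddMonoid _ (DirectSum.decompose Q.deg q) = _
  rw [this, DirectSum.toAddMonoid_of]
  rfl

/-- The graded homomorphism `q ↦ ∑ qₙ xⁿ`. -/
noncomputable def GrMod.homogenize (Q : GrMod 𝓐) : GrHom Q (laurent 𝓐 Q) :=
  ⟨Laurent.toLin 𝓐 Q.homogenizeAdd fun d a ha q => by
    induction q using Q.induction with
    | hom n q hq =>
      rw [Q.homogenizeAdd_apply hq, Q.homogenizeAdd_apply (Q.smul_mem hq ha),
        Laurent.smul_mono ha]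
    | add q r hq hr => rw [smul_add, map_add, map_add, smul_add, hq, hr],
  fun n q hq => ⟨q, (Q.homogenizeAdd_apply hq).symm⟩⟩

theorem GrMod.homogenize_apply (Q : GrMod 𝓐) {n : ℤ} {q : Q} (hq : q ∈ Q.deg n) :
    Q.homogenize.toLin q = Laurent.mono 𝓐 n q :=
  Q.homogenizeAdd_apply hq

theorem GrMod.coeff_homogenize (Q : GrMod 𝓐) (n : ℤ) (q : Q) :
    Laurent.coeff (𝓐 := 𝓐) n (Q.homogenize.toLin q) = Q.proj n q := by
  induction q using Q.induction with
  | hom m q hq =>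
    rw [Q.homogenize_apply hq]
    by_cases h : n = m
    · subst h
      rw [Laurent.coeff_mono_same, Q.proj_same n q hq]
    · rw [Laurent.coeff_mono_ne h, Q.proj_ne n m h q hq]
  | add q r hq hr => rw [map_add, map_add, map_add, hq, hr]

/-- The lattice is generated under x by the homogenized elements ∑ qₙ xⁿ. Modulo x only these
remain, and none of them but zero lies in xN, so N/xN is a copy of Q. -/
theorem GrProj.grClass_forget (H : HasFiniteResolutions 𝓐) (Q : GrProj 𝓐) :
    Q.forget.grClass 𝓐 = Q.bar := by
  let M := Q.toGrMod
  let L := LinearMap.range M.homogenize.toLin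
  have hom : (laurent 𝓐 M).IsHomog L := by
    have := M.homogenize.isHomog_map M.isHomog_top
    rwa [Submodule.map_top] at this
  have hL : L.FG := by
    have : Module.Finite Aᵐᵒᵖ M := Q.finite
    exact Module.Finite.fg_top.map M.homogenize.toLin |> fun h => by rwa [Submodule.map_top] at h
  have hspan : Submodule.span Aᵐᵒᵖ {q : M | ∃ n, q ∈ M.deg n} = ⊤ := by
    refine eq_top_iff.2 fun q _ => ?_
    induction q using M.induction with
    | hom n q hq => exact Submodule.subset_span ⟨n, hq⟩
    | add q r hq hr => exact add_mem (hq trivial) (hr trivial)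
  have hlat := Laurent.isLattice L hL hom hspan fun q ⟨n, hn⟩ =>
    ⟨n, q, M.homogenize_apply hn⟩
  have hmem : ∀ q, M.homogenize.toLin q ∈ ⨆ j : ℕ, L.map ((Laurent.x 𝓐 M).toLin ^ j) := fun q =>
    le_iSup_map_pow (Laurent.x 𝓐 M) L ⟨q, rfl⟩
  let φ : M →ₗ[Aᵐᵒᵖ] hlat.gr := (subqMk hlat.homog ((Laurent.x 𝓐 M).isHomog_map hlat.homog)).comp
    (M.homogenize.toLin.codRestrict _ hmem)
  let Φ : GrHom M hlat.gr := ⟨φ, fun n q hq =>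
    ⟨⟨M.homogenize.toLin q, hmem q⟩, M.homogenize.map_deg n q hq, rfl⟩⟩
  have hφ : Function.Bijective φ := by
    constructor
    · rw [injective_iff_map_eq_zero]
      intro q hq
      have hq' := (subqMk_eq_zero _ _ _).1 hq
      obtain ⟨u, hu, e⟩ := hq'
      -- In `xʲ ∑ rₙ xⁿ` the coefficient of `xⁿ` has degree `n - j`. For an element of `x N` all
      -- exponents `j` are at least one, so nothing of degree `n` occurs there, whereas the
      -- homogenization of `q` has `qₙ` there.
      have key : ∀ n, M.proj n (Laurent.coeff (𝓐 := 𝓐) n ((Laurent.x 𝓐 M).toLin u)) = 0 := by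
        intro n
        clear e
        induction hu using Submodule.iSup_induction' with
        | mem j u hu =>
          obtain ⟨_, ⟨r, rfl⟩, rfl⟩ := hu
          rw [Laurent.x_pow]
          change M.proj n (Laurent.coeff (𝓐 := 𝓐) n (Laurent.shiftBy 1 (Laurent.shiftBy (j : ℤ) _))) = 0
          rw [Laurent.shiftBy_shiftBy, Laurent.coeff_shiftBy, M.coeff_homogenize]
          exact M.proj_proj_ne (by omega) r
        | zero => rw [map_zero, map_zero, map_zero]
        | add u v _ _ hu hv => rw [map_add, map_add, map_add, hu, hv, add_zero]
      refine M.ext_proj fun n => ?_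
      have := key n
      rw [e] at this
      change M.proj n (Laurent.coeff (𝓐 := 𝓐) n (M.homogenize.toLin q)) = 0 at this
      rw [M.coeff_homogenize, M.proj_same n _ (M.proj_mem n q)] at this
      rw [this, map_zero]
    · intro y
      obtain ⟨⟨u, hu⟩, rfl⟩ := subqMk_surjective _ _ y
      obtain ⟨_, ⟨q, rfl⟩, v, hv, e⟩ := Submodule.mem_sup.1 (iSup_map_pow_le (Laurent.x 𝓐 M) L hu)
      refine ⟨q, ?_⟩
      rw [eq_comm, ← sub_eq_zero]
      change subqMk _ _ _ - subqMk _ _ _ = _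
      rw [← map_sub, subqMk_eq_zero]
      change u - M.homogenize.toLin q ∈ _
      rw [← e, add_sub_cancel_left]
      exact hv
  rw [← IsLattice.euler_gr H Q.forget hlat, ← euler_proj]
  exact (H.euler_congr Q.finite Φ hφ).symm

/-! ## The map to `K₀(A)` -/

theorem grothendieckAddGroup_lift_of {M G : Type*} [AddCommMonoid M] [AddCommGroup G]
    (f : M →+ G) (m : M) :
    Algebra.GrothendieckAddGroup.lift f (Algebra.GrothendieckAddGroup.of m) = f m :=
  DFunLike.congr_fun (Algebra.GrothendieckAddGroup.lift.symm_apply_apply f) m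

theorem grothendieckAddGroup_hom_ext {M G : Type*} [AddCommMonoid M] [AddCommGroup G]
    {f g : Algebra.GrothendieckAddGroup M →+ G}
    (h : ∀ m, f (Algebra.GrothendieckAddGroup.of m) = g (Algebra.GrothendieckAddGroup.of m)) :
    f = g :=
  Algebra.GrothendieckAddGroup.lift.symm.injective (AddMonoidHom.ext h)

theorem K0.cls_prod (P Q : FGProj A) : K0.cls (P.prod Q) = K0.cls P + K0.cls Q :=
  map_add (Algebra.GrothendieckAddGroup.of (M := V A)) (V.mk P) (V.mk Q)

theorem K0.cls_zero : K0.cls (FGProj.zero A) = 0 :=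
  map_zero (Algebra.GrothendieckAddGroup.of (M := V A))

theorem K0.cls_congr {P Q : FGProj A} (e : P ≃ₗ[Aᵐᵒᵖ] Q) : K0.cls P = K0.cls Q :=
  congrArg Algebra.GrothendieckAddGroup.of (Quotient.sound ⟨e⟩ : V.mk P = V.mk Q)

variable (𝓐) in
/-- The homomorphism `K₀^gr(A) → K₀(A)` that forgets the grading. -/
noncomputable def forgetHom : K0Gr 𝓐 →+ K0 A :=
  Algebra.GrothendieckAddGroup.lift
    { toFun := Quotient.lift (fun P : GrProj 𝓐 => K0.cls P.forget) fun _ _ ⟨e, _⟩ =>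
        K0.cls_congr e
      map_zero' := (K0.cls_congr (LinearEquiv.refl Aᵐᵒᵖ PUnit.{u + 1})).trans K0.cls_zero
      map_add' := by
        rintro ⟨P⟩ ⟨Q⟩
        exact K0.cls_prod P.forget Q.forget }

theorem forgetHom_cls (P : GrProj 𝓐) : forgetHom 𝓐 (K0Gr.cls P) = K0.cls P.forget :=
  grothendieckAddGroup_lift_of _ (VGr.mk P)

theorem shiftSubgroup_le_ker : K0Gr.shiftSubgroup 𝓐 ≤ (forgetHom 𝓐).ker := by
  rw [K0Gr.shiftSubgroup, AddSubgroup.closure_le]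
  rintro _ ⟨P, rfl⟩
  change forgetHom 𝓐 (_ - _) = 0
  rw [map_sub, forgetHom_cls, forgetHom_cls, sub_eq_zero]
  exact K0.cls_congr (LinearEquiv.refl Aᵐᵒᵖ P.carrier)

variable (𝓐) in
/-- The homomorphism `K₀^gr(A) / ⟨[P(1)] - [P]⟩ → K₀(A)` that forgets the grading. -/
noncomputable def forgetBar : KBar 𝓐 →+ K0 A :=
  QuotientAddGroup.lift _ (forgetHom 𝓐) shiftSubgroup_le_ker

theorem forgetBar_bar (P : GrProj 𝓐) : forgetBar 𝓐 P.bar = K0.cls P.forget :=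
  forgetHom_cls P

/-- The homomorphism induced by `grHom` is a left inverse; this is checked on the classes [P], where
it is `GrProj.grClass_forget`. -/
theorem forgetBar_injective (H : HasFiniteResolutions 𝓐) : Function.Injective (forgetBar 𝓐) := by
  refine Function.LeftInverse.injective (g := Algebra.GrothendieckAddGroup.lift (grHom H)) ?_
  suffices ((Algebra.GrothendieckAddGroup.lift (grHom H)).comp (forgetBar 𝓐)) =
      AddMonoidHom.id (KBar 𝓐) from fun c => DFunLike.congr_fun this c
  refine QuotientAddGroup.addMonoidHom_ext _ (grothendieckAddGroup_hom_ext ?_)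
  rintro ⟨P⟩
  change Algebra.GrothendieckAddGroup.lift (grHom H) (forgetBar 𝓐 P.bar) = P.bar
  rw [forgetBar_bar, ← P.grClass_forget H]
  exact grothendieckAddGroup_lift_of _ (V.mk P.forget)

/-- Stably isomorphic modules have the same Euler characteristic in `K₀(A)`. -/
theorem HasEuler.cls_sub_cls {n : ℕ} {L L' : GrMod 𝓐} {c c' : KBar 𝓐} (h : HasEuler n L c)
    (h' : HasEuler n L' c') (X Y : FGProj A) (e : (L × Y) ≃ₗ[Aᵐᵒᵖ] (L' × X)) :
    K0.cls X - K0.cls Y = forgetBar 𝓐 c - forgetBar 𝓐 c' := by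
  induction n generalizing L L' c c' X Y with
  | zero =>
    obtain ⟨P, ⟨a, _⟩, rfl⟩ := h
    obtain ⟨P', ⟨a', _⟩, rfl⟩ := h'
    rw [forgetBar_bar, forgetBar_bar, sub_eq_sub_iff_add_eq_add, add_comm, ← K0.cls_prod,
      ← K0.cls_prod]
    exact K0.cls_congr (((a.prodCongr (LinearEquiv.refl Aᵐᵒᵖ Y)).trans e).trans
      (a'.prodCongr (LinearEquiv.refl Aᵐᵒᵖ X)).symm).symm
  | succ n ih =>
    obtain ⟨K, P, f, g, d, hs, hK, rfl⟩ := h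
    obtain ⟨K', P', f', g', d', hs', hK', rfl⟩ := h'
    have : Module.Projective Aᵐᵒᵖ P.carrier := P.projective.projective
    have : Module.Projective Aᵐᵒᵖ P'.carrier := P'.projective.projective
    let G : (P.carrier × Y) →ₗ[Aᵐᵒᵖ] (L × Y) := g.toLin.prodMap LinearMap.id
    let G' : (P'.carrier × X) →ₗ[Aᵐᵒᵖ] (L' × X) := g'.toLin.prodMap LinearMap.id
    have hG : Function.Surjective G := hs.surj.prodMap Function.surjective_id
    have hG' : Function.Surjective G' := hs'.surj.prodMap Function.surjective_id
    -- As `e` need not respect degrees, the liftings are ungraded; graded projective modules remain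
    -- projective after forgetting the grading.
    obtain ⟨a, ha⟩ := Module.projective_lifting_property G' (e.toLinearMap.comp G) hG'
    obtain ⟨b, hb⟩ := Module.projective_lifting_property (e.toLinearMap.comp G) G'
      (e.surjective.comp hG)
    obtain ⟨Φ, _⟩ := schanuel_linear (f := (LinearMap.inl Aᵐᵒᵖ P.carrier Y).comp f.toLin) (g := G)
      (f' := (LinearMap.inl Aᵐᵒᵖ P'.carrier X).comp f'.toLin) (g' := G')
      ((LinearMap.inl_injective (R := Aᵐᵒᵖ)).comp hs.inj) (exact_prodMap_id Y hs.exact)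
      ((LinearMap.inl_injective (R := Aᵐᵒᵖ)).comp hs'.inj) (exact_prodMap_id X hs'.exact) e a b
      (LinearMap.congr_fun ha) (LinearMap.congr_fun hb)
    -- The syzygies satisfy `K' ⊕ (P ⊕ Y) ≅ K ⊕ (P' ⊕ X)`, so the two sides exchange roles, matching
    -- the alternating sign.
    have := ih hK' hK (P'.forget.prod X) (P.forget.prod Y) Φ.symm
    rw [K0.cls_prod, K0.cls_prod] at this
    rw [map_sub, map_sub, forgetBar_bar, forgetBar_bar]
    have e1 : K0.cls X - K0.cls Y = (K0.cls P'.forget + K0.cls X - (K0.cls P.forget + K0.cls Y)) +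
        (K0.cls P.forget - K0.cls P'.forget) := by abel
    rw [e1, this]
    abel

end Class

/-! ### Surjectivity: truncating the sequence given by 1 - x and evaluation -/

section Surjective

variable {A : Type u} [Ring A] {𝓐 : ℤ → AddSubgroup A} [GradedRing 𝓐]

/-! ## Surjectivity -/

variable {P : Type u} [AddCommGroup P] [Module Aᵐᵒᵖ P]

namespace Laurent

theorem map_shiftBy_map (F : Submodule Aᵐᵒᵖ (Laurent 𝓐 P)) (j k : ℤ) :
    (F.map (shiftBy j)).map (shiftBy k) = F.map (shiftBy (j + k)) := by
  rw [← Submodule.map_comp]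
  congr 1
  exact LinearMap.ext fun f => shiftBy_shiftBy k j f

theorem map_shiftBy_zero (F : Submodule Aᵐᵒᵖ (Laurent 𝓐 P)) : F.map (shiftBy 0) = F := by
  have : (shiftBy 0 : Laurent 𝓐 P →ₗ[Aᵐᵒᵖ] _) = LinearMap.id := LinearMap.ext shiftBy_zero
  rw [this, Submodule.map_id]

/-- High powers of `x` times any monomial lie in the sum by `shiftBy_mem_of_span`, and the sum over
all integers is stable under division by `x`. -/
theorem iSup_map_shiftBy_eq_top {S : Set P} (hS : Submodule.span Aᵐᵒᵖ S = ⊤) :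
    ⨆ j : ℤ, (Submodule.span Aᵐᵒᵖ (mono 𝓐 0 '' S)).map (shiftBy j) = ⊤ := by
  set F := Submodule.span Aᵐᵒᵖ (mono 𝓐 0 '' S) with hF
  have hstab : ∀ k : ℤ, ∀ f ∈ ⨆ j : ℤ, F.map (shiftBy j),
      shiftBy k f ∈ ⨆ j : ℤ, F.map (shiftBy j) := by
    intro k f hf
    have : (⨆ j : ℤ, F.map (shiftBy j)).map (shiftBy k) ≤ ⨆ j : ℤ, F.map (shiftBy j) := by
      rw [Submodule.map_iSup]
      refine iSup_le fun j => ?_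
      rw [map_shiftBy_map]
      exact le_iSup (fun j => F.map (shiftBy j)) (j + k)
    exact this ⟨f, hf, rfl⟩
  refine eq_top_iff.2 fun f _ => ?_
  induction f using Laurent.induction with
  | add f g hf hg => exact add_mem (hf trivial) (hg trivial)
  | mono n p =>
    obtain ⟨c, hc⟩ := shiftBy_mem_of_span (⨆ j : ℤ, F.map (shiftBy j)) hS (fun s hs n =>
      ⟨0, fun d _ => Submodule.mem_iSup_of_mem (n + d) ⟨mono 𝓐 0 s,
        Submodule.subset_span ⟨s, hs, rfl⟩, by rw [shiftBy_mono, zero_add]⟩⟩) p n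
    have := hstab (-c) _ (hc c le_rfl)
    rwa [shiftBy_mono, add_neg_cancel_right] at this

/-- The sum of the `xʲ F` for `|j| ≤ m`. -/
noncomputable def window (F : Submodule Aᵐᵒᵖ (Laurent 𝓐 P)) (m : ℕ) :
    Submodule Aᵐᵒᵖ (Laurent 𝓐 P) :=
  ⨆ j ∈ Finset.Icc (-(m : ℤ)) m, F.map (shiftBy j)

theorem map_shiftBy_le_window (F : Submodule Aᵐᵒᵖ (Laurent 𝓐 P)) {m : ℕ} {j : ℤ} (h : -(m : ℤ) ≤ j)
    (h' : j ≤ m) : F.map (shiftBy j) ≤ window F m :=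
  le_iSup₂ (f := fun j (_ : j ∈ Finset.Icc (-(m : ℤ)) m) => F.map (shiftBy j)) j
    (Finset.mem_Icc.2 ⟨h, h'⟩)

theorem fg_window {F : Submodule Aᵐᵒᵖ (Laurent 𝓐 P)} (hF : F.FG) (m : ℕ) : (window F m).FG :=
  Submodule.fg_biSup _ _ fun _ _ => hF.map _

theorem isHomog_window {F : Submodule Aᵐᵒᵖ (Laurent 𝓐 P)} (hF : (laurent 𝓐 P).IsHomog F) (m : ℕ) :
    (laurent 𝓐 P).IsHomog (window F m) :=
  GrMod.IsHomog.iSup fun j => GrMod.IsHomog.iSup fun _ => hF.map _ j (shiftBy_deg j)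

/-- Finitely generated submodules are compact, so finitely many translates of `F` suffice. -/
theorem exists_le_window {F Y : Submodule Aᵐᵒᵖ (Laurent 𝓐 P)}
    (hF : ⨆ j : ℤ, F.map (shiftBy j) = ⊤) (hY : Y.FG) : ∃ m, Y ≤ window F m := by
  obtain ⟨t, ht⟩ := CompleteLattice.IsCompactElement.exists_finset_of_le_iSup _
    ((Submodule.fg_iff_compact Y).1 hY) (fun j : ℤ => F.map (shiftBy j)) (hF ▸ le_top)
  refine ⟨t.sup Int.natAbs, ht.trans (iSup₂_le fun j hj => ?_)⟩
  have : j.natAbs ≤ t.sup Int.natAbs := Finset.le_sup hj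
  exact map_shiftBy_le_window F (by omega) (by omega)

theorem map_oneSub_le (L : Submodule Aᵐᵒᵖ (Laurent 𝓐 P)) :
    L.map (oneSub 𝓐 P) ≤ L ⊔ L.map (shiftBy 1) := by
  rintro _ ⟨f, hf, rfl⟩
  rw [oneSub_apply]
  exact sub_mem (Submodule.mem_sup_left hf) (Submodule.mem_sup_right ⟨f, hf, rfl⟩)

/-- Modulo `(1 - x) L`, where `L = window F m`, the elements `xᵏ f` and `xᵏ⁺¹ f` agree whenever `xᵏ
f ∈ L`. This applies for `-m ≤ k ≤ m`, so all `xʲ F` with `-m ≤ j ≤ m + 1` collapse onto `F`; these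
are the translates that make up `L + x L`. -/
theorem window_le (F : Submodule Aᵐᵒᵖ (Laurent 𝓐 P)) (m : ℕ) :
    window F m ⊔ (window F m).map (shiftBy 1) ≤ F ⊔ (window F m).map (oneSub 𝓐 P) := by
  set L := window F m with hL
  have hpos : ∀ k : ℕ, k ≤ m + 1 → ∀ f ∈ F, shiftBy (k : ℤ) f ∈ F ⊔ L.map (oneSub 𝓐 P) := by
    intro k
    induction k with
    | zero =>
      intro _ f hf
      rw [Nat.cast_zero, shiftBy_zero]
      exact Submodule.mem_sup_left hf
    | succ k ih =>
      intro hk f hf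
      have h1 : shiftBy (k : ℤ) f ∈ L :=
        map_shiftBy_le_window F (by omega) (by omega) ⟨f, hf, rfl⟩
      have h2 := sub_mem (ih (by omega) f hf)
        (Submodule.mem_sup_right (S := F) (Submodule.mem_map_of_mem (f := oneSub 𝓐 P) h1))
      rwa [oneSub_apply, sub_sub_cancel, shiftBy_shiftBy, ← Nat.cast_succ] at h2
  have hneg : ∀ k : ℕ, k ≤ m → ∀ f ∈ F, shiftBy (-k : ℤ) f ∈ F ⊔ L.map (oneSub 𝓐 P) := by
    intro k
    induction k with
    | zero =>
      intro _ f hf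
      rw [Nat.cast_zero, neg_zero, shiftBy_zero]
      exact Submodule.mem_sup_left hf
    | succ k ih =>
      intro hk f hf
      have h1 : shiftBy (-(k + 1 : ℕ) : ℤ) f ∈ L :=
        map_shiftBy_le_window F (by omega) (by omega) ⟨f, hf, rfl⟩
      have h2 := add_mem (ih (by omega) f hf)
        (Submodule.mem_sup_right (S := F) (Submodule.mem_map_of_mem (f := oneSub 𝓐 P) h1))
      rw [oneSub_apply, shiftBy_shiftBy, show (-(k + 1 : ℕ) + 1 : ℤ) = -k by push_cast; ring,
        add_sub_cancel] at h2
      exact h2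
  have hall : ∀ j : ℤ, -(m : ℤ) ≤ j → j ≤ m + 1 →
      F.map (shiftBy j) ≤ F ⊔ L.map (oneSub 𝓐 P) := by
    rintro j h1 h2 _ ⟨f, hf, rfl⟩
    rcases le_total 0 j with h | h
    · have := hpos j.toNat (by omega) f hf
      rwa [Int.toNat_of_nonneg h] at this
    · have := hneg (-j).toNat (by omega) f hf
      rwa [Int.toNat_of_nonneg (by omega), neg_neg] at this
  refine sup_le (iSup₂_le fun j hj => ?_) ?_
  · rw [Finset.mem_Icc] at hj
    exact hall j hj.1 (by omega)
  · rw [hL, window, Submodule.map_iSup]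
    refine iSup_le fun j => ?_
    rw [Submodule.map_iSup]
    refine iSup_le fun hj => ?_
    rw [Finset.mem_Icc] at hj
    rw [map_shiftBy_map]
    exact hall (j + 1) (by omega) (by omega)

/-- A finitely generated projective module `P` fits into an exact sequence
`0 → L → L' → P → 0` with `L` and `L'` finitely generated homogeneous submodules of
`P[x, x⁻¹]`. -/
theorem exists_window (hP : Module.Finite Aᵐᵒᵖ P) (hP' : Module.Projective Aᵐᵒᵖ P) :
    ∃ L L' : Submodule Aᵐᵒᵖ (Laurent 𝓐 P), L.FG ∧ L'.FG ∧ (laurent 𝓐 P).IsHomog L ∧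
      (laurent 𝓐 P).IsHomog L' ∧ (∀ f ∈ L, oneSub 𝓐 P f ∈ L') ∧
      (∀ p, ∃ f ∈ L', eval 𝓐 P f = p) ∧
      ∀ f ∈ L', eval 𝓐 P f = 0 → ∃ g ∈ L, oneSub 𝓐 P g = f := by
  obtain ⟨S, hS⟩ := hP.1
  set F := Submodule.span Aᵐᵒᵖ (mono 𝓐 0 '' (S : Set P)) with hF
  have hFfg : F.FG := Submodule.fg_span (S.finite_toSet.image _)
  have hFhom : (laurent 𝓐 P).IsHomog F := isHomog_span_mono _ 0
  have hFsurj : ∀ p, ∃ f ∈ F, eval 𝓐 P f = p := by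
    have : F.map (eval 𝓐 P) = ⊤ := by
      rw [hF, Submodule.map_span, ← hS, Set.image_image]
      simp only [eval_mono, Set.image_id']
    intro p
    have hp : p ∈ F.map (eval 𝓐 P) := this ▸ trivial
    exact hp
  -- This kernel need not be homogeneous, so the graded Noetherian condition would not apply to it.
  -- It is finitely generated because `P` is finitely presented.
  have hker : (LinearMap.ker ((eval 𝓐 P).domRestrict F)).FG := by
    have := Module.finitePresentation_of_projective Aᵐᵒᵖ P
    have : Module.Finite Aᵐᵒᵖ F := Module.Finite.iff_fg.2 hFfg
    exact Module.FinitePresentation.fg_ker _ fun p => by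
      obtain ⟨f, hf, e⟩ := hFsurj p
      exact ⟨⟨f, hf⟩, e⟩
  set K := (LinearMap.ker ((eval 𝓐 P).domRestrict F)).map F.subtype with hK
  have hYmap : (K.comap (oneSub 𝓐 P)).map (oneSub 𝓐 P) = K := by
    refine Submodule.map_comap_eq_of_le ?_
    rintro _ ⟨f, hf, rfl⟩
    exact (exact_oneSub_eval _).1 hf
  have hY : (K.comap (oneSub 𝓐 P)).FG := by
    refine Submodule.fg_of_fg_map_injective (oneSub 𝓐 P) oneSub_injective ?_
    rw [hYmap]
    exact hker.map _
  -- The window is taken large enough to contain the preimage of `K` under `1 - x`.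
  obtain ⟨m, hm⟩ := exists_le_window (iSup_map_shiftBy_eq_top (𝓐 := 𝓐) hS) hY
  refine ⟨window F m, window F m ⊔ (window F m).map (shiftBy 1), fg_window hFfg m,
    (fg_window hFfg m).sup ((fg_window hFfg m).map _), isHomog_window hFhom m,
    (isHomog_window hFhom m).sup ((isHomog_window hFhom m).map _ 1 (shiftBy_deg 1)),
    fun f hf => map_oneSub_le _ ⟨f, hf, rfl⟩, fun p => ?_, fun f hf h0 => ?_⟩
  · obtain ⟨f, hf, e⟩ := hFsurj p
    refine ⟨f, Submodule.mem_sup_left ?_, e⟩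
    have := map_shiftBy_le_window F (m := m) (j := 0) (by omega) (by omega)
    rw [map_shiftBy_zero] at this
    exact this hf
  -- By `window_le`, `f` is `g + (1 - x) l` with `g ∈ F` and `l` in the window. Then `g` evaluates
  -- to zero, so it lies in `K` and is `(1 - x) y` with `y` in the window too.
  · obtain ⟨g, hg, _, ⟨l, hl, rfl⟩, rfl⟩ := Submodule.mem_sup.1 (window_le F m hf)
    have hg0 : eval 𝓐 P g = 0 := by
      rwa [map_add, (exact_oneSub_eval _).2 ⟨l, rfl⟩, add_zero] at h0
    have hgK : g ∈ K := ⟨⟨g, hg⟩, hg0, rfl⟩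
    rw [← hYmap] at hgK
    obtain ⟨y, hy, rfl⟩ := hgK
    exact ⟨y + l, add_mem (hm hy) hl, map_add _ _ _⟩

end Laurent

/-- Since `P` is projective, the sequence of `exists_window` splits and L ⊕ P ≅ L' over A. Then
`HasEuler.cls_sub_cls`, with X = 0 and Y = P, expresses -[P] as the image of χ(L) - χ(L'). -/
theorem cls_mem_range_forgetBar (H : HasFiniteResolutions 𝓐) (P : FGProj A) :
    K0.cls P ∈ (forgetBar 𝓐).range := by
  obtain ⟨L, L', hL, hL', hom, hom', h1, h2, h3⟩ :=
    Laurent.exists_window (𝓐 := 𝓐) P.finite P.projective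
  let ε : L' →ₗ[Aᵐᵒᵖ] P := (Laurent.eval 𝓐 P).domRestrict L'
  obtain ⟨s, hs⟩ := Module.projective_lifting_property ε LinearMap.id fun p => by
    obtain ⟨f, hf, e⟩ := h2 p
    exact ⟨⟨f, hf⟩, e⟩
  have hs' : ∀ p, ε (s p) = p := LinearMap.congr_fun hs
  let δ : L →ₗ[Aᵐᵒᵖ] L' := (Laurent.oneSub 𝓐 P).restrict h1
  have hδ : ∀ l, ε (δ l) = 0 := fun l => (Laurent.exact_oneSub_eval _).2 ⟨l, rfl⟩
  have hbij : Function.Bijective (δ.coprod s) := by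
    constructor
    · rw [injective_iff_map_eq_zero]
      rintro ⟨l, p⟩ h
      rw [LinearMap.coprod_apply] at h
      have hp : p = 0 := by
        have := congrArg ε h
        rwa [map_add, hδ, hs', zero_add, map_zero] at this
      subst hp
      rw [map_zero, add_zero] at h
      have hl : l = 0 := Subtype.ext (Laurent.oneSub_injective
        ((congrArg Subtype.val h).trans (map_zero _).symm))
      rw [hl]
      rfl
    · intro f
      obtain ⟨g, hg, e⟩ := h3 (f - s (ε f) : L') (Subtype.property _) (by
        change ε (f - s (ε f)) = 0
        rw [map_sub, hs', sub_self])
      refine ⟨(⟨g, hg⟩, ε f), ?_⟩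
      have : δ ⟨g, hg⟩ = f - s (ε f) := Subtype.ext e
      rw [LinearMap.coprod_apply, this, sub_add_cancel]
  let M := (laurent 𝓐 P).sub L hom
  let M' := (laurent 𝓐 P).sub L' hom'
  obtain ⟨n, hn⟩ := H.exists_hasEuler M (Module.Finite.iff_fg.2 hL)
  obtain ⟨n', hn'⟩ := H.exists_hasEuler M' (Module.Finite.iff_fg.2 hL')
  have := (hn.mono (le_max_left n n')).cls_sub_cls (hn'.mono (le_max_right n n'))
    (FGProj.zero A) P ((LinearEquiv.ofBijective (δ.coprod s) hbij).trans
      (LinearEquiv.prodUnique : (L' × PUnit.{u + 1}) ≃ₗ[Aᵐᵒᵖ] L').symm)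
  rw [K0.cls_zero, zero_sub, ← map_sub] at this
  exact ⟨-(euler M - euler M'), by rw [map_neg, ← this, neg_neg]⟩

theorem forgetBar_surjective (H : HasFiniteResolutions 𝓐) : Function.Surjective (forgetBar 𝓐) := by
  -- Surjectivity becomes the vanishing of the projection of K₀(A) onto the quotient by the range,
  -- which can be tested on the classes [P].
  rw [← AddMonoidHom.range_eq_top, ← QuotientAddGroup.ker_mk' (forgetBar 𝓐).range,
    AddMonoidHom.ker_eq_top_iff]
  refine grothendieckAddGroup_hom_ext ?_
  rintro ⟨P⟩
  exact (QuotientAddGroup.eq_zero_iff _).2 (cls_mem_range_forgetBar H P)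

end Surjective

end GrK

theorem mainTheorem3 {A : Type u} [Ring A] (𝓐 : ℤ → AddSubgroup A) [GradedRing 𝓐]
    (hreg : GrK.IsGrRightRegular 𝓐) (hnoeth : GrK.IsGrRightNoetherian 𝓐) :
    ∃ e : (GrK.K0Gr 𝓐 ⧸ GrK.K0Gr.shiftSubgroup 𝓐) ≃+ GrK.K0 A,
      ∀ P : GrK.GrProj 𝓐,
        e (QuotientAddGroup.mk (GrK.K0Gr.cls P)) = GrK.K0.cls P.forget := by
  have H := GrK.hasFiniteResolutions hreg hnoeth
  exact ⟨AddEquiv.ofBijective (GrK.forgetBar 𝓐)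
    ⟨GrK.forgetBar_injective H, GrK.forgetBar_surjective H⟩, GrK.forgetBar_bar⟩
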